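/- Let $L\subset S^3$ be an oriented link with $h$ components, given by an oriented diagram on $S^2$ that is connected (as a 4-valent graph) and in which every component passes over at least one crossing and under at least one crossing. Let $n$ be the number of regions of the diagram. Assign a variable $w_r\in\mathbb C^\times$ to each region and a variable $m_i\in\mathbb C^\times$ to each component, and write $\mathbf w=(w_1,\dots,w_n)$, $\mathbf m=(m_1,\dots,m_h)$. Draw each crossing $c$ with both strands pointing upwards. Let $w_j,w_k,w_l,w_m$ be the variables of its bottom, right, top and left corner, and let $m_\alpha$, $m_\beta$ be the variables of the components of the strand going to the top left and of the strand going to the top right, respectively. The crossing is positive if the strand going to the top right is the over-strand, and negative otherwise. With $\mathrm{Li}_2(z)=-\int_0^z\frac{\log(1-t)}t\,dt$ and principal branches, let $$\mathbb W_c=\mathrm{Li}_2\Big(\tfrac{w_m}{m_\beta w_j}\Big)+\mathrm{Li}_2\Big(\tfrac{w_k}{m_\alpha w_j}\Big)-\mathrm{Li}_2\Big(\tfrac{w_l}{m_\beta w_k}\Big)-\mathrm{Li}_2\Big(\tfrac{w_l}{m_\alpha w_m}\Big)+\mathrm{Li}_2\Big(\tfrac{w_jw_l}{w_mw_k}\Big)-\tfrac{\pi^2}6+\log\Big(\tfrac{w_m}{m_\beta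 w_j}\Big)\log\Big(\tfrac{w_k}{m_\alpha w_j}\Big)$$ if $c$ is positive, and $$\mathbb W_c=-\mathrm{Li}_2\Big(\tfrac{m_\beta w_m}{w_j}\Big)-\mathrm{Li}_2\Big(\tfrac{m_\alpha w_k}{w_j}\Big)+\mathrm{Li}_2\Big(\tfrac{m_\beta w_l}{w_k}\Big)+\mathrm{Li}_2\Big(\tfrac{m_\alpha w_l}{w_m}\Big)-\mathrm{Li}_2\Big(\tfrac{w_jw_l}{w_mw_k}\Big)+\tfrac{\pi^2}6-\log\Big(\tfrac{m_\beta w_m}{w_j}\Big)\log\Big(\tfrac{m_\alpha w_k}{w_j}\Big)$$ if $c$ is negative. Let $\mathbb W=\sum_c\mathbb W_c$. A point $(\mathbf w,\mathbf m)\in(\mathbb C^\times)^{n+h}$ is a *solution* if $\mathbb W$ is differentiable there in each $w_r$ and $\exp\big(w_r\,\partial\mathbb W/\partial w_r\big)=1$ for all regions $r$. It is *non-degenerate* if at each crossing the five arguments of $\mathrm{Li}_2$ above are all different from $1$. Let $p,q\in S^3\setminus L$ be points above and below the diagram. The complement of $L\cup\{p,q\}$ is a union of ideal octahedra, one between the two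 strands of each crossing, with one vertex at the over-strand, one at the under-strand and four equatorial vertices alternately at $p$ and at $q$. The edge joining the two $p$-vertices and the edge joining the two $q$-vertices cut the octahedron into five ideal tetrahedra: a middle one with vertices $p,p,q,q$, two at the over-strand with vertices on the over-strand, $p,p,q$, and two at the under-strand with vertices on the under-strand, $p,q,q$. For a non-degenerate solution $(\mathbf w,\mathbf m)$, give them the following cross-ratios. At a positive crossing: - the over-strand tetrahedra whose $q$-vertex lies between the corners $j,m$, resp. $k,l$, have $\frac{w_m}{m_\beta w_j}$, resp. $\frac{m_\beta w_k}{w_l}$, at the edge from the over-strand to $q$; - the middle one has $\frac{w_jw_l}{w_mw_k}$ at $pp$ (and at $qq$); - the under-strand tetrahedra whose $p$-vertex lies between the corners $j,k$, resp. $m,l$, have $\frac{w_k}{m_\alpha w_j}$, resp. $\frac{m_\alpha w_m}{w_l}$, at the edge from the under-strand to $p$. At a negative crossing: - the over-strand tetrahedra at $j,k$, resp. $m,l$, have $\frac{w_j}{m_\alpha w_k}$, resp. $\frac{m_\alpha w_l}{w_m}$, at the edge from the over-strand to $q$; - the middle one has $\frac{w_mw_k}{w_jw_l}$ at $pp$ (and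 at $qq$); - the under-strand tetrahedra at $j,m$, resp. $k,l$, have $\frac{w_j}{m_\beta w_m}$, resp. $\frac{m_\beta w_l}{w_k}$, at the edge from the under-strand to $p$. Let $\rho_{\mathbf w,\mathbf m}:\pi_1(S^3\setminus L)=\pi_1(S^3\setminus(L\cup\{p,q\}))\to\mathrm{PSL}(2,\mathbb C)$ be the holonomy representation of this ideal triangulation. That is, there is a $\rho_{\mathbf w,\mathbf m}$-equivariant map from the ideal vertices of the universal cover to $\mathbb{CP}^1$ that takes the vertices of every lifted tetrahedron to four distinct points with the given cross-ratio. **Theorem.** Let $\rho:\pi_1(S^3\setminus L)\to\mathrm{PSL}(2,\mathbb C)$ be a representation with $\rho(\mu_i)\ne\pm I$ for the meridian $\mu_i$ of every component, and suppose that $\rho$ admits an $\mathrm{SL}(2,\mathbb C)$-lifting. Then there is a non-degenerate solution $(\mathbf w,\mathbf m)$ whose holonomy representation $\rho_{\mathbf w,\mathbf m}$ exists, is unique up to conjugation, and agrees with $\rho$ up to conjugation. -/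

import Mathlib

open scoped LinearAlgebra.Projectivization MatrixGroups

/-! ### Oriented link diagrams on the sphere -/

/-- The two strands at a crossing. -/
inductive Strand where
  | over
  | under
  deriving DecidableEq

/-- The four corners at a crossing.  The crossing is drawn so that both strands point upwards:
`south` is the corner between the two incoming half-edges, `north` the corner between the two
outgoing half-edges, `west` and `east` are the corners on the left and on the right. -/
inductive Corner where
  | south
  | east
  | north
  | west
  deriving DecidableEq

/-- A signed Gauss diagram: a finite set of signed crossings, together with the rule that tells,
for each strand leaving a crossing, at which crossing and on which strand the oriented edge that
begins there arrives.  It records an oriented 4-valent graph with a cyclic order of the half-edges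
and over/under information at each vertex. -/
structure GaussDiagram where
  /-- the crossings -/
  Crossing : Type
  [fintypeCrossing : Fintype Crossing]
  /-- `true` for a positive (right-handed) crossing, `false` for a negative one -/
  positive : Crossing → Bool
  /-- the edge that leaves `c` on the strand `s` arrives at `(next (c, s)).1` on the strand
  `(next (c, s)).2` -/
  next : Equiv.Perm (Crossing × Strand)

namespace GaussDiagram

attribute [instance] GaussDiagram.fintypeCrossing

variable (D : GaussDiagram)

/-- The edges of the underlying 4-valent graph; `(c, s)` is the edge that leaves the crossing `c`
on the strand `s`. -/
abbrev Edge : Type := D.Crossing × Strand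

/-- The edge that arrives at the crossing `c` on the strand `s`. -/
def inEdge (c : D.Crossing) (s : Strand) : D.Edge := D.next.symm (c, s)

/-- The edge that leaves the crossing `c` on the strand `s`. -/
def outEdge (c : D.Crossing) (s : Strand) : D.Edge := (c, s)

/-- The strand that runs from the bottom left to the top right: the over-strand of a positive
crossing, the under-strand of a negative one. -/
def upRight (c : D.Crossing) : Strand := if D.positive c then .over else .under

/-- The strand that runs from the bottom right to the top left. -/
def upLeft (c : D.Crossing) : Strand := if D.positive c then .under else .over

/-- The corner on the left of the incoming half of the strand `s` at `c`. -/
def inLeft (c : D.Crossing) (s : Strand) : Corner := if s = D.upRight c then .west else .south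

/-- The corner on the right of the incoming half of the strand `s` at `c`. -/
def inRight (c : D.Crossing) (s : Strand) : Corner := if s = D.upRight c then .south else .east

/-- The corner on the left of the outgoing half of the strand `s` at `c`. -/
def outLeft (c : D.Crossing) (s : Strand) : Corner := if s = D.upRight c then .north else .west

/-- The corner on the right of the outgoing half of the strand `s` at `c`. -/
def outRight (c : D.Crossing) (s : Strand) : Corner := if s = D.upRight c then .east else .north

/-- Two corners at the two ends of an edge that lie on the same side of this edge. -/
inductive CornerAdj : D.Crossing × Corner → D.Crossing × Corner → Prop
  | left (c : D.Crossing) (s : Strand) :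
      CornerAdj (c, D.outLeft c s)
        ((D.next (c, s)).1, D.inLeft (D.next (c, s)).1 (D.next (c, s)).2)
  | right (c : D.Crossing) (s : Strand) :
      CornerAdj (c, D.outRight c s)
        ((D.next (c, s)).1, D.inRight (D.next (c, s)).1 (D.next (c, s)).2)

/-- The regions (faces) of the diagram, as classes of corners. -/
def Region : Type := Quot D.CornerAdj

/-- The region that contains a given corner of a given crossing. -/
def region (c : D.Crossing) (k : Corner) : D.Region := Quot.mk _ (c, k)

/-- The region on the left of an edge. -/
def leftRegion (e : D.Edge) : D.Region := D.region e.1 (D.outLeft e.1 e.2)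

/-- The region on the right of an edge. -/
def rightRegion (e : D.Edge) : D.Region := D.region e.1 (D.outRight e.1 e.2)

/-- The components of the link: the cycles of edges obtained by going straight on at every
crossing. -/
def Component : Type := Quotient (Equiv.Perm.SameCycle.setoid D.next)

/-- The component that contains a given edge. -/
def component (e : D.Edge) : D.Component := Quotient.mk _ e

end GaussDiagram

/-- An oriented link diagram on the 2-sphere whose underlying 4-valent graph is connected and
cellularly embedded.  With `c` vertices and `2 * c` edges, the closed oriented surface obtained by
gluing discs to the regions is the sphere exactly if there are `c + 2` regions. -/
structure LinkDiagram extends GaussDiagram where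
  connected : ∀ c c' : Crossing,
    Relation.EqvGen (fun a b => ∃ s : Strand, (next (a, s)).1 = b) c c'
  planar : Nat.card toGaussDiagram.Region = Nat.card Crossing + 2

namespace LinkDiagram

variable (D : LinkDiagram)

/-- Every component passes over at least one crossing and under at least one crossing. -/
def EveryComponentOverUnder : Prop :=
  ∀ i : D.Component,
    (∃ c, D.component (D.outEdge c .over) = i) ∧ (∃ c, D.component (D.outEdge c .under) = i)

/-! ### The link group -/

/-- The Wirtinger relators.  There is one generator for each edge: the loop that starts at the
viewer above the diagram, goes down through the region on the right of the edge, passes under the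
edge, and returns through the region on its left.  Products of loops are read from left to
right. -/
inductive IsWirtingerRelator : FreeGroup D.Edge → Prop
  | over (c : D.Crossing) :
      IsWirtingerRelator
        (FreeGroup.of (D.inEdge c .over) * (FreeGroup.of (D.outEdge c .over))⁻¹)
  | under_pos (c : D.Crossing) (h : D.positive c = true) :
      IsWirtingerRelator
        ((FreeGroup.of (D.outEdge c .over))⁻¹ * FreeGroup.of (D.inEdge c .under) *
          FreeGroup.of (D.outEdge c .over) * (FreeGroup.of (D.outEdge c .under))⁻¹)
  | under_neg (c : D.Crossing) (h : D.positive c = false) :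
      IsWirtingerRelator
        (FreeGroup.of (D.outEdge c .over) * FreeGroup.of (D.inEdge c .under) *
          (FreeGroup.of (D.outEdge c .over))⁻¹ * (FreeGroup.of (D.outEdge c .under))⁻¹)

/-- The link group `π₁(S³ ∖ L)`, by its Wirtinger presentation. -/
abbrev LinkGroup : Type := PresentedGroup {r : FreeGroup D.Edge | D.IsWirtingerRelator r}

/-- The meridian around an edge.  The meridians around the edges of one component are conjugate to
each other; each of them is a meridian of this component. -/
def meridian (e : D.Edge) : D.LinkGroup := PresentedGroup.of e

end LinkDiagram

/-! ### The generalized potential function -/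

/-- The dilogarithm `Li₂(z) = -∫₀ᶻ log (1 - t) / t dt`, principal branch, as an integral along the
segment from `0` to `z`. -/
noncomputable def dilog (z : ℂ) : ℂ :=
  -∫ t in (0 : ℝ)..1, Complex.log (1 - (t : ℂ) * z) / (t : ℂ)

namespace LinkDiagram

variable (D : LinkDiagram)

/-- The variable of the component of the strand from the bottom right to the top left. -/
def mα (m : D.Component → ℂ) (c : D.Crossing) : ℂ := m (D.component (D.outEdge c (D.upLeft c)))

/-- The variable of the component of the strand from the bottom left to the top right. -/
def mβ (m : D.Component → ℂ) (c : D.Crossing) : ℂ := m (D.component (D.outEdge c (D.upRight c)))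

/-- The contribution of a crossing to the generalized potential function.  The region variables
are `wj` (south), `wk` (east), `wl` (north), `wm` (west). -/
noncomputable def crossingPotential (w : D.Region → ℂ) (m : D.Component → ℂ)
    (c : D.Crossing) : ℂ :=
  let wj := w (D.region c .south)
  let wk := w (D.region c .east)
  let wl := w (D.region c .north)
  let wm := w (D.region c .west)
  let a := D.mα m c
  let b := D.mβ m c
  if D.positive c then
    dilog (wm / (b * wj)) + dilog (wk / (a * wj)) - dilog (wl / (b * wk)) - dilog (wl / (a * wm))
      + dilog (wj * wl / (wm * wk)) - (Real.pi : ℂ) ^ 2 / 6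
      + Complex.log (wm / (b * wj)) * Complex.log (wk / (a * wj))
  else
    -dilog (b * wm / wj) - dilog (a * wk / wj) + dilog (b * wl / wk) + dilog (a * wl / wm)
      - dilog (wj * wl / (wm * wk)) + (Real.pi : ℂ) ^ 2 / 6
      - Complex.log (b * wm / wj) * Complex.log (a * wk / wj)

/-- The generalized potential function of the diagram. -/
noncomputable def potential (w : D.Region → ℂ) (m : D.Component → ℂ) : ℂ :=
  ∑ c : D.Crossing, D.crossingPotential w m c

open scoped Classical in
/-- The critical equations `exp (w_r ∂W/∂w_r) = 1` for all regions `r`, at a point where these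
partial derivatives exist. -/
def IsSolution (w : D.Region → ℂ) (m : D.Component → ℂ) : Prop :=
  ∀ r : D.Region,
    DifferentiableAt ℂ (fun z => D.potential (Function.update w r z) m) (w r) ∧
    Complex.exp (w r * deriv (fun z => D.potential (Function.update w r z) m) (w r)) = 1

/-- Non-degeneracy: five ratios at each crossing differ from `1`. -/
def IsNondegenerate (w : D.Region → ℂ) (m : D.Component → ℂ) : Prop :=
  ∀ c : D.Crossing,
    let wj := w (D.region c .south)
    let wk := w (D.region c .east)
    let wl := w (D.region c .north)
    let wm := w (D.region c .west)
    let a := D.mα m c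
    let b := D.mβ m c
    if D.positive c then
      wm / (b * wj) ≠ 1 ∧ wk / (a * wj) ≠ 1 ∧ wl / (b * wk) ≠ 1 ∧ wl / (a * wm) ≠ 1 ∧
        wj * wl / (wm * wk) ≠ 1
    else
      b * wm / wj ≠ 1 ∧ a * wk / wj ≠ 1 ∧ b * wl / wk ≠ 1 ∧ a * wl / wm ≠ 1 ∧
        wj * wl / (wk * wm) ≠ 1

end LinkDiagram

/-! ### Ideal tetrahedra -/

/-- The ideal boundary of hyperbolic 3-space, on which `PSL(2, ℂ)` acts by Möbius
transformations. -/
abbrev CP1 : Type := ℙ ℂ (Fin 2 → ℂ)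

/-- The determinant of two vectors in the plane. -/
def bracket (u v : Fin 2 → ℂ) : ℂ := u 0 * v 1 - u 1 * v 0

/-- The cross-ratio `(z₀ - z₃) (z₁ - z₂) / ((z₀ - z₂) (z₁ - z₃))`, in homogeneous coordinates. -/
noncomputable def crossRatio (z₀ z₁ z₂ z₃ : CP1) : ℂ :=
  bracket z₀.rep z₃.rep * bracket z₁.rep z₂.rep / (bracket z₀.rep z₂.rep * bracket z₁.rep z₃.rep)

/-- `z₀, z₁, z₂, z₃` are the vertices of a non-degenerate ideal tetrahedron whose cross-ratio at
the edge `z₀ z₁` is `z`. -/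
def IsIdealTetrahedron (z : ℂ) (z₀ z₁ z₂ z₃ : CP1) : Prop :=
  z₀ ≠ z₁ ∧ z₀ ≠ z₂ ∧ z₀ ≠ z₃ ∧ z₁ ≠ z₂ ∧ z₁ ≠ z₃ ∧ z₂ ≠ z₃ ∧ crossRatio z₀ z₁ z₂ z₃ = z

/-! ### The holonomy representation of a point `(w, m)`

The complement of the link and of two points `p` (the viewer, above the diagram) and `q` (below
the diagram) is the union of one ideal octahedron per crossing.  The octahedron at a crossing has
one vertex at the over-strand, one at the under-strand, and four equatorial vertices, alternately
at `p` and at `q`; its four equatorial edges run from `p` to `q` through the four corners of the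
crossing.  It is cut into five tetrahedra, by the edge that joins its two vertices at `p` and the
edge that joins its two vertices at `q`.

A point of the universal cover is a class of paths from `p`, and the link group acts by
precomposition with loops.  The lifts of the ideal vertices are the translates of
* the trivial path (a lift of `p`);
* for each region, the straight path down through this region to `q`;
* for each edge of the diagram, the straight path down to this edge of the link. -/

namespace LinkDiagram

variable (D : LinkDiagram)

/-- A developing map of the ideal vertices of the universal cover that is equivariant under
`ρ`, given by its values on the lifts listed above. -/
structure DevelopingMap (ρ : D.LinkGroup →* PSL(2, ℂ)) where
  /-- the image of the lift of `p` -/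
  top : CP1
  /-- the images of the lifts of `q` -/
  bottom : D.Region → CP1
  /-- the images of the lifts of the ideal points on the link -/
  cusp : D.Edge → CP1
  /-- the meridian loop around an edge, followed by the path through the left region, is the path
  through the right region -/
  bottom_eq : ∀ e, bottom (D.rightRegion e) = ρ (D.meridian e) • bottom (D.leftRegion e)
  /-- the meridian loop around an edge fixes the ideal point on this edge -/
  cusp_fixed : ∀ e, ρ (D.meridian e) • cusp e = cusp e
  /-- the path to the over-strand may slide along the over-strand -/
  cusp_over : ∀ c, cusp (D.inEdge c .over) = cusp (D.outEdge c .over)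
  /-- sliding along the under-strand changes the path by the meridian of the over-strand -/
  cusp_under : ∀ c, cusp (D.inEdge c .under) =
    (if D.positive c then ρ (D.meridian (D.outEdge c .over))
      else (ρ (D.meridian (D.outEdge c .over)))⁻¹) • cusp (D.outEdge c .under)

/-- The five tetrahedra at each crossing are developed to ideal tetrahedra with the cross-ratios
that `(w, m)` assigns to them.  The lift of the octahedron that is used has its vertices at: the
over-strand (`o`), the incoming half of the under-strand (`u`), the viewer (`p`), the viewer seen
across the over-strand (`p'`), and `q` seen through the two corners of the crossing that are on
the same side of the over-strand as the incoming under-strand (`q`, `q'`). -/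
def DevelopingMap.HasShape {D : LinkDiagram} {ρ : D.LinkGroup →* PSL(2, ℂ)}
    (d : D.DevelopingMap ρ) (w : D.Region → ℂ) (m : D.Component → ℂ) : Prop :=
  ∀ c : D.Crossing,
    let wj := w (D.region c .south)
    let wk := w (D.region c .east)
    let wl := w (D.region c .north)
    let wm := w (D.region c .west)
    let a := D.mα m c
    let b := D.mβ m c
    let g := ρ (D.meridian (D.outEdge c .over))
    let o := d.cusp (D.outEdge c .over)
    let u := d.cusp (D.inEdge c .under)
    let p := d.top
    let q := d.bottom (D.region c .south)
    if D.positive c then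
      let p' := g • p
      let q' := d.bottom (D.region c .east)
      IsIdealTetrahedron (wm / (b * wj)) o q p' p ∧
      IsIdealTetrahedron (b * wk / wl) o q' p p' ∧
      IsIdealTetrahedron (wj * wl / (wm * wk)) p p' q' q ∧
      IsIdealTetrahedron (wk / (a * wj)) u p q' q ∧
      IsIdealTetrahedron (a * wm / wl) u p' q q'
    else
      let p' := g⁻¹ • p
      let q' := d.bottom (D.region c .west)
      IsIdealTetrahedron (wj / (a * wk)) o q p p' ∧
      IsIdealTetrahedron (a * wl / wm) o q' p' p ∧
      IsIdealTetrahedron (wm * wk / (wj * wl)) p p' q q' ∧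
      IsIdealTetrahedron (wj / (b * wm)) u p q q' ∧
      IsIdealTetrahedron (b * wl / wk) u p' q' q

/-- `ρ` is a holonomy representation of the ideal triangulation with the cross-ratios given by
`(w, m)`. -/
def IsHolonomy (w : D.Region → ℂ) (m : D.Component → ℂ) (ρ : D.LinkGroup →* PSL(2, ℂ)) : Prop :=
  ∃ d : D.DevelopingMap ρ, d.HasShape w m

end LinkDiagram

/-! Lift `ρ` to `φ` with values in `SL(2, ℂ)` and develop the octahedra by vectors of `ℂ²` instead
of points of the projective line. Choose a vector `p` above the diagram, a vector `q r` below it for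
every region with `q (right) = φ (meridian) • q (left)` across each edge, and an eigenvector `v e`
of every meridian, with one eigenvalue `l i` for each component. Then put `w r = det (p, q r)` and
`m i = 1 / l i`. Since `SL(2, ℂ)` preserves determinants, every determinant between `p`, its
translates and the `q r` at a crossing reduces to such quantities, and `det (v, g x) = l⁻¹ det (v,
x)` for an eigenvector brings in the component variables. Hence the lines of these vectors have the
prescribed cross-ratios (`CrossingVectors.isOctahedron`).

The critical equations follow from the Plücker relation: not only the arguments `z` of the
dilogarithm but also the numbers `1 - z` are monomials in determinants. Each corner factor of `exp
(w ∂W/∂w)` therefore splits into factors `det (v, q) / det (v, p)` at the two half-edges that bound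
the corner (`CrossingVectors.positiveFactor_eq`), and these cancel around a region
(`prod_corner_eq_one`).

The vectors `q r` exist because the sphere is simply connected. Combinatorially this is the
tree-cotree argument: a spanning tree of the diagram and Euler's formula make the remaining edges a
spanning tree of the dual graph (`exists_region_coloring`). The base vector of the `q r`, and then
`p`, are chosen generically, which uses that no meridian is central. All arguments of the
dilogarithm then become non-real, so they avoid the branch cuts and the value `1`.

Uniqueness is rigidity. A Möbius transformation that matches one face of two developed octahedra of
the same shape matches all their vertices, and this propagates over the connected diagram. The part
of the link group that changes the lift is then forced, so the two representations are conjugate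
(`exists_conj`). -/

/-! ### Colorings of the regions -/

/-- On a connected graph whose number of edges is one less than its number of vertices, every
edge labelling by group elements is the coboundary of a vertex labelling. -/
theorem exists_potential_of_card {R B Γ : Type*} [Group Γ] [Finite R] [Nonempty R] (l r : B → R)
    (A : Finset B)
    (conn : ∀ f : R → Prop, (∀ b ∈ A, f (l b) ↔ f (r b)) → ∀ x y, f x → f y)
    (hcard : A.card + 1 = Nat.card R) (g : B → Γ) :
    ∃ F : R → Γ, ∀ b ∈ A, F (r b) = g b * F (l b) := by
  classical
  have := Fintype.ofFinite R
  have key : ∀ n : ℕ, n + 1 ≤ Nat.card R → ∃ (S : Finset R) (A' : Finset B) (F : R → Γ),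
      S.card = n + 1 ∧ A'.card = n ∧ A' ⊆ A ∧ (∀ b ∈ A', l b ∈ S ∧ r b ∈ S) ∧
      ∀ b ∈ A', F (r b) = g b * F (l b) := by
    intro n
    induction n with
    | zero =>
      intro _
      exact ⟨{Classical.arbitrary R}, ∅, 1, by simp⟩
    | succ n ih =>
      intro hn
      obtain ⟨S, A', F, hS, hA', hsub, hmem, hF⟩ := ih (by omega)
      -- Otherwise `conn` would make `S` everything, against its size. The end of `b` outside `S`
      -- has no value imposed on it so far, so it can be assigned the one that `b` requires.
      have hb : ∃ b ∈ A, ¬ (l b ∈ S ↔ r b ∈ S) := by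
        by_contra! h
        obtain ⟨x, hx⟩ : S.Nonempty := Finset.card_pos.mp (by omega)
        have huniv : S = Finset.univ :=
          Finset.eq_univ_iff_forall.mpr fun y => conn (· ∈ S) h x y hx
        rw [huniv, Finset.card_univ, ← Nat.card_eq_fintype_card] at hS
        omega
      obtain ⟨b, hbA, hb⟩ := hb
      have hbA' : b ∉ A' := fun h => hb (iff_of_true (hmem b h).1 (hmem b h).2)
      have extend : ∀ (y : R) (v : Γ), y ∉ S →
          ∀ e ∈ A', Function.update F y v (r e) = g e * Function.update F y v (l e) := by
        intro y v hy e he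
        rw [Function.update_of_ne, Function.update_of_ne, hF e he]
        · rintro rfl; exact hy (hmem e he).1
        · rintro rfl; exact hy (hmem e he).2
      by_cases hl : l b ∈ S
      · have hr : r b ∉ S := fun h => hb (iff_of_true hl h)
        refine ⟨insert (r b) S, insert b A', Function.update F (r b) (g b * F (l b)),
          by rw [Finset.card_insert_of_notMem hr, hS], by rw [Finset.card_insert_of_notMem hbA', hA'],
          Finset.insert_subset hbA hsub, ?_, ?_⟩
        · intro e he
          rcases Finset.mem_insert.mp he with rfl | he
          · simp [hl]
          · simp [hmem e he]
        · intro e he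
          rcases Finset.mem_insert.mp he with rfl | he
          · rw [Function.update_self, Function.update_of_ne]
            rintro h; exact hr (h ▸ hl)
          · exact extend _ _ hr e he
      · have hr : r b ∈ S := by by_contra h; exact hb (iff_of_false hl h)
        refine ⟨insert (l b) S, insert b A', Function.update F (l b) ((g b)⁻¹ * F (r b)),
          by rw [Finset.card_insert_of_notMem hl, hS], by rw [Finset.card_insert_of_notMem hbA', hA'],
          Finset.insert_subset hbA hsub, ?_, ?_⟩
        · intro e he
          rcases Finset.mem_insert.mp he with rfl | he
          · simp [hr]
          · simp [hmem e he]
        · intro e he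
          rcases Finset.mem_insert.mp he with rfl | he
          · rw [Function.update_self, Function.update_of_ne, mul_inv_cancel_left]
            rintro h; exact hl (h ▸ hr)
          · exact extend _ _ hl e he
  obtain ⟨S, A', F, -, hA', hsub, -, hF⟩ := key A.card hcard.le
  -- The tree has used up all edges of `A`, so no cycle imposes a further condition.
  rw [Finset.eq_of_subset_of_card_le hsub hA'.ge] at hF
  exact ⟨F, hF⟩

instance : Fintype Strand where
  elems := {.over, .under}
  complete s := by cases s <;> simp

instance : Fintype Corner where
  elems := {.south, .east, .north, .west}
  complete s := by cases s <;> simp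

theorem card_strand : Fintype.card Strand = 2 := rfl

/-! ### The two sides of an edge, and flat labellings. -/

namespace GaussDiagram

variable (D : GaussDiagram)

theorem upLeft_ne_upRight (c : D.Crossing) : D.upLeft c ≠ D.upRight c := by
  unfold upLeft upRight; split <;> decide

theorem eq_upRight_or_upLeft (c : D.Crossing) (s : Strand) : s = D.upRight c ∨ s = D.upLeft c := by
  unfold upLeft upRight; cases s <;> split <;> simp

theorem leftRegion_inEdge (c : D.Crossing) (s : Strand) :
    D.leftRegion (D.inEdge c s) = D.region c (D.inLeft c s) := by
  have h := Quot.sound (CornerAdj.left (D := D) (D.next.symm (c, s)).1 (D.next.symm (c, s)).2)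
  simp only [Prod.mk.eta, Equiv.apply_symm_apply] at h
  exact h

theorem rightRegion_inEdge (c : D.Crossing) (s : Strand) :
    D.rightRegion (D.inEdge c s) = D.region c (D.inRight c s) := by
  have h := Quot.sound (CornerAdj.right (D := D) (D.next.symm (c, s)).1 (D.next.symm (c, s)).2)
  simp only [Prod.mk.eta, Equiv.apply_symm_apply] at h
  exact h

theorem leftRegion_outEdge (c : D.Crossing) (s : Strand) :
    D.leftRegion (D.outEdge c s) = D.region c (D.outLeft c s) := rfl

theorem rightRegion_outEdge (c : D.Crossing) (s : Strand) :
    D.rightRegion (D.outEdge c s) = D.region c (D.outRight c s) := rfl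

theorem leftRegion_inEdge_upRight (c : D.Crossing) :
    D.leftRegion (D.inEdge c (D.upRight c)) = D.region c .west := by
  simp [leftRegion_inEdge, inLeft]

theorem rightRegion_inEdge_upRight (c : D.Crossing) :
    D.rightRegion (D.inEdge c (D.upRight c)) = D.region c .south := by
  simp [rightRegion_inEdge, inRight]

theorem leftRegion_inEdge_upLeft (c : D.Crossing) :
    D.leftRegion (D.inEdge c (D.upLeft c)) = D.region c .south := by
  simp [leftRegion_inEdge, inLeft, upLeft_ne_upRight]

theorem rightRegion_inEdge_upLeft (c : D.Crossing) :
    D.rightRegion (D.inEdge c (D.upLeft c)) = D.region c .east := by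
  simp [rightRegion_inEdge, inRight, upLeft_ne_upRight]

theorem leftRegion_outEdge_upRight (c : D.Crossing) :
    D.leftRegion (D.outEdge c (D.upRight c)) = D.region c .north := by
  simp [leftRegion_outEdge, outLeft]

theorem rightRegion_outEdge_upRight (c : D.Crossing) :
    D.rightRegion (D.outEdge c (D.upRight c)) = D.region c .east := by
  simp [rightRegion_outEdge, outRight]

theorem leftRegion_outEdge_upLeft (c : D.Crossing) :
    D.leftRegion (D.outEdge c (D.upLeft c)) = D.region c .west := by
  simp [leftRegion_outEdge, outLeft, upLeft_ne_upRight]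

theorem rightRegion_outEdge_upLeft (c : D.Crossing) :
    D.rightRegion (D.outEdge c (D.upLeft c)) = D.region c .north := by
  simp [rightRegion_outEdge, outRight, upLeft_ne_upRight]

theorem inEdge_next (e : D.Edge) : D.inEdge (D.next e).1 (D.next e).2 = e := by
  simp [inEdge]

/-- A labelling of the edges by group elements with trivial holonomy around every crossing. -/
def IsFlat {Γ : Type*} [Group Γ] (g : D.Edge → Γ) : Prop :=
  ∀ c, g (D.inEdge c (D.upLeft c)) * g (D.inEdge c (D.upRight c)) =
    g (D.outEdge c (D.upRight c)) * g (D.outEdge c (D.upLeft c))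

/-- If a region coloring is compatible with a flat labelling at three of the four half-edges at a
crossing, then also at the fourth one. -/
theorem IsFlat.coloring_of_three {D : GaussDiagram} {Γ : Type*} [Group Γ] {g : D.Edge → Γ}
    (hg : D.IsFlat g) (F : D.Region → Γ) (c : D.Crossing) (t : D.Edge)
    (ht : (∃ s, t = D.inEdge c s ∧ ∀ s', D.outEdge c s' ≠ t) ∨
      (∃ s, t = D.outEdge c s ∧ ∀ s', D.inEdge c s' ≠ t))
    (h : ∀ e, e ≠ t → (∃ s, e = D.inEdge c s ∨ e = D.outEdge c s) →
      F (D.rightRegion e) = g e * F (D.leftRegion e)) :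
    F (D.rightRegion t) = g t * F (D.leftRegion t) := by
  have hc := hg c
  have hin : ∀ s s', s ≠ s' → D.inEdge c s ≠ D.inEdge c s' := by
    intro s s' hs h
    exact hs (congrArg Prod.snd (D.next.symm.injective h))
  have hout : ∀ s s', s ≠ s' → D.outEdge c s ≠ D.outEdge c s' := by
    intro s s' hs h
    exact hs (congrArg Prod.snd h)
  have hi := fun s (hs : D.inEdge c s ≠ t) => h _ hs ⟨s, Or.inl rfl⟩
  have ho := fun s (hs : D.outEdge c s ≠ t) => h _ hs ⟨s, Or.inr rfl⟩
  have hne := D.upLeft_ne_upRight c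
  have i1 := hi (D.upRight c)
  have i2 := hi (D.upLeft c)
  have o1 := ho (D.upRight c)
  have o2 := ho (D.upLeft c)
  rw [rightRegion_inEdge_upRight, leftRegion_inEdge_upRight] at i1
  rw [rightRegion_inEdge_upLeft, leftRegion_inEdge_upLeft] at i2
  rw [rightRegion_outEdge_upRight, leftRegion_outEdge_upRight] at o1
  rw [rightRegion_outEdge_upLeft, leftRegion_outEdge_upLeft] at o2
  -- By `ht` the edge `t` is not a loop at `c`, so the other three half-edges differ from `t`.
  -- Flatness says that the four jumps around `c` compose to the identity, hence three of them
  -- determine the fourth.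
  rcases ht with ⟨s, rfl, hs⟩ | ⟨s, rfl, hs⟩
  · replace o1 := o1 (hs _)
    replace o2 := o2 (hs _)
    rcases D.eq_upRight_or_upLeft c s with rfl | rfl
    · rw [rightRegion_inEdge_upRight, leftRegion_inEdge_upRight]
      replace i2 := i2 (hin _ _ hne)
      rw [o2, ← mul_assoc, ← hc, i2, mul_assoc] at o1
      exact mul_left_cancel o1
    · rw [rightRegion_inEdge_upLeft, leftRegion_inEdge_upLeft]
      replace i1 := i1 (hin _ _ hne.symm)
      rw [i1, o1, o2, ← mul_assoc, ← mul_assoc, hc]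
  · replace i1 := i1 (hs _)
    replace i2 := i2 (hs _)
    rcases D.eq_upRight_or_upLeft c s with rfl | rfl
    · rw [rightRegion_outEdge_upRight, leftRegion_outEdge_upRight]
      replace o2 := o2 (hout _ _ hne)
      rw [i2, i1, o2, ← mul_assoc, ← mul_assoc, hc]
    · rw [rightRegion_outEdge_upLeft, leftRegion_outEdge_upLeft]
      replace o1 := o1 (hout _ _ hne.symm)
      rw [i1, o1, ← mul_assoc, hc, mul_assoc] at i2
      exact mul_left_cancel i2

/-- A set of edges is peelable if a region coloring that is compatible with a flat labelling off
this set is compatible with it everywhere. -/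
def IsPeelable (T : Finset D.Edge) : Prop :=
  ∀ (Γ : Type) [Group Γ] (g : D.Edge → Γ) (F : D.Region → Γ), D.IsFlat g →
    (∀ e ∉ T, F (D.rightRegion e) = g e * F (D.leftRegion e)) →
    ∀ e, F (D.rightRegion e) = g e * F (D.leftRegion e)

end GaussDiagram

/-! ### Trees, cotrees and region colorings on the sphere. -/

namespace LinkDiagram

open GaussDiagram

variable (D : LinkDiagram)

/-- Without crossings there are no corners and hence no regions, whereas `planar` would demand two.
-/
theorem nonempty_crossing : Nonempty D.Crossing := by
  by_contra h
  rw [not_nonempty_iff] at h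
  have hR : IsEmpty D.Region := by
    refine ⟨fun r => ?_⟩
    induction r using Quot.ind with
    | mk x => exact h.elim x.1
  have := D.planar
  simp at this

instance : Finite D.Region := Quot.finite _

instance : Nonempty D.Region := by
  obtain ⟨c⟩ := D.nonempty_crossing
  exact ⟨D.region c .south⟩

/-- Induction along the underlying graph. -/
theorem crossing_induction {P : D.Crossing → Prop}
    (h : ∀ e : D.Edge, P e.1 ↔ P (D.next e).1) (c c' : D.Crossing) : P c → P c' := by
  have hg := D.connected c c'
  have : P c ↔ P c' := by
    induction hg with
    | rel a b hab => obtain ⟨s, rfl⟩ := hab; exact h (a, s)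
    | refl => rfl
    | symm _ _ _ ih => exact ih.symm
    | trans _ _ _ _ _ ih1 ih2 => exact ih1.trans ih2
  exact this.mp

/-- The underlying graph has a spanning tree, and spanning trees can be peeled off leaf by leaf. -/
theorem exists_isPeelable : ∃ T : Finset D.Edge, T.card + 1 = Fintype.card D.Crossing ∧
    D.IsPeelable T := by
  classical
  have key : ∀ n : ℕ, n + 1 ≤ Fintype.card D.Crossing → ∃ (S : Finset D.Crossing)
      (T : Finset D.Edge), S.card = n + 1 ∧ T.card = n ∧ (∀ t ∈ T, t.1 ∈ S ∧ (D.next t).1 ∈ S) ∧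
      D.IsPeelable T := by
    intro n
    induction n with
    | zero =>
      intro _
      obtain ⟨c⟩ := D.nonempty_crossing
      exact ⟨{c}, ∅, rfl, rfl, by simp, fun Γ _ g F _ h e => h e (by simp)⟩
    | succ n ih =>
      intro hn
      obtain ⟨S, T, hS, hT, hmem, hpeel⟩ := ih (by omega)
      obtain ⟨t, ht⟩ : ∃ t : D.Edge, ¬ (t.1 ∈ S ↔ (D.next t).1 ∈ S) := by
        by_contra! h
        obtain ⟨x, hx⟩ : S.Nonempty := Finset.card_pos.mp (by omega)
        have huniv : S = Finset.univ :=
          Finset.eq_univ_iff_forall.mpr fun y => D.crossing_induction h x y hx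
        rw [huniv, Finset.card_univ] at hS
        omega
      have htT : t ∉ T := fun h => ht (iff_of_true (hmem t h).1 (hmem t h).2)
      obtain ⟨v, hv, hvt, hSt⟩ : ∃ v, v ∉ S ∧ ((∃ s, t = D.inEdge v s ∧ ∀ s', D.outEdge v s' ≠ t) ∨
          (∃ s, t = D.outEdge v s ∧ ∀ s', D.inEdge v s' ≠ t)) ∧
          t.1 ∈ insert v S ∧ (D.next t).1 ∈ insert v S := by
        by_cases h1 : t.1 ∈ S
        · have h2 : (D.next t).1 ∉ S := fun h => ht (iff_of_true h1 h)
          refine ⟨_, h2, Or.inl ⟨(D.next t).2, (D.inEdge_next t).symm, ?_⟩, by simp [h1], by simp⟩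
          intro s' h
          apply h2
          have := congrArg Prod.fst h
          simp only [outEdge] at this
          rwa [this]
        · have h2 : (D.next t).1 ∈ S := by by_contra h; exact ht (iff_of_false h1 h)
          refine ⟨_, h1, Or.inr ⟨t.2, rfl, ?_⟩, by simp, by simp [h2]⟩
          intro s' h
          apply h1
          rw [← h] at h2
          simpa [inEdge, h] using h2
      refine ⟨insert v S, insert t T, by rw [Finset.card_insert_of_notMem hv, hS],
        by rw [Finset.card_insert_of_notMem htT, hT], ?_, ?_⟩
      · intro e he
        rcases Finset.mem_insert.mp he with rfl | he
        · exact hSt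
        · exact ⟨Finset.mem_insert_of_mem (hmem e he).1, Finset.mem_insert_of_mem (hmem e he).2⟩
      · intro Γ _ g F hg hF
        -- The new vertex `v` is a leaf: edges of `T` have both ends in `S`, so `t` is the only tree
        -- edge at `v`. The other three half-edges at `v` force the equation at `t`, and the smaller
        -- tree `T` remains to be peeled.
        refine hpeel Γ g F hg fun e he => ?_
        by_cases het : e = t
        · subst het
          refine hg.coloring_of_three F v e hvt fun e' he' hinc => hF e' ?_
          rw [Finset.mem_insert, not_or]
          refine ⟨he', fun h => ?_⟩
          obtain ⟨s, rfl | rfl⟩ := hinc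
          · have := (hmem _ h).2
            simp [inEdge] at this
            exact hv this
          · exact hv (hmem _ h).1
        · exact hF e (by simp [het, he])
  have hpos : 0 < Fintype.card D.Crossing := Fintype.card_pos_iff.mpr D.nonempty_crossing
  obtain ⟨S, T, -, hT, -, hpeel⟩ := key (Fintype.card D.Crossing - 1) (by omega)
  exact ⟨T, by omega, hpeel⟩

/-- The regions are connected to each other by crossing edges. -/
theorem region_induction {P : D.Region → Prop}
    (h : ∀ e : D.Edge, P (D.leftRegion e) ↔ P (D.rightRegion e)) (r r' : D.Region) :
    P r → P r' := by
  have hcorner : ∀ (c : D.Crossing) (k : Corner), P (D.region c k) ↔ P (D.region c .south) := by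
    intro c k
    have i1 := h (D.inEdge c (D.upRight c))
    have i2 := h (D.inEdge c (D.upLeft c))
    have o2 := h (D.outEdge c (D.upLeft c))
    rw [rightRegion_inEdge_upRight, leftRegion_inEdge_upRight] at i1
    rw [rightRegion_inEdge_upLeft, leftRegion_inEdge_upLeft] at i2
    rw [rightRegion_outEdge_upLeft, leftRegion_outEdge_upLeft] at o2
    cases k <;> tauto
  have hcross := D.crossing_induction (P := fun c => P (D.region c .south)) fun e => by
    have e1 : D.leftRegion e = D.region e.1 (D.outLeft e.1 e.2) := rfl
    have e2 := D.leftRegion_inEdge (D.next e).1 (D.next e).2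
    rw [inEdge_next] at e2
    rw [← hcorner e.1 (D.outLeft e.1 e.2), ← e1, e2, hcorner]
  induction r using Quot.ind with
  | mk x =>
  induction r' using Quot.ind with
  | mk y =>
  exact fun hx => (hcorner y.1 y.2).mpr (hcross _ _ ((hcorner x.1 x.2).mp hx))

/-- A flat labelling of the edges of a diagram on the sphere comes from a coloring of the
regions. -/
theorem exists_region_coloring {Γ : Type} [Group Γ] (g : D.Edge → Γ) (hg : D.IsFlat g) :
    ∃ F : D.Region → Γ, ∀ e, F (D.rightRegion e) = g e * F (D.leftRegion e) := by
  classical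
  obtain ⟨T, hT, hpeel⟩ := D.exists_isPeelable
  obtain ⟨F, hF⟩ := exists_potential_of_card D.leftRegion D.rightRegion Tᶜ (fun f hf => by
    refine D.region_induction fun e => ?_
    -- The dual graph stays connected after the edges of `T` are removed: the indicator of `f` is a
    -- coloring for the trivial labelling off `T`, and peeling extends this across `T`. The group
    -- `ℤ` only has to supply two distinct values.
    have := hpeel (Multiplicative ℤ) 1 (fun r => if f r then Multiplicative.ofAdd 1 else 1)
      (fun c => by simp) (fun e he => by
        simp only [Pi.one_apply, one_mul]
        rw [if_congr (hf e (by simpa using he)).symm rfl rfl]) e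
    simp only [Pi.one_apply, one_mul] at this
    split_ifs at this with h1 h2 h2
    · tauto
    · exact absurd this (by decide)
    · exact absurd this (by decide)
    · tauto)
    (by
      -- Genus zero enters here: with `c` crossings there are `2c - (c - 1) = c + 1` edges off the
      -- tree and `c + 2` regions.
      rw [D.planar, Finset.card_compl, Nat.card_eq_fintype_card, Fintype.card_prod, card_strand]
      omega) g
  exact ⟨F, hpeel Γ g F hg fun e he => hF e (by simpa using he)⟩

end LinkDiagram

/-! ### Generic points -/

section Generic

variable {E : Type*} [NormedAddCommGroup E] [NormedSpace ℂ E]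

/-- Identity theorem: vanishing on a non-empty open set would force vanishing everywhere. -/
theorem AnalyticOnNhd.dense_ne_zero {f : E → ℂ} (hf : AnalyticOnNhd ℂ f Set.univ)
    (h : ∃ x, f x ≠ 0) : Dense {x | f x ≠ 0} := by
  rw [dense_iff_inter_open]
  intro U hU ⟨x, hx⟩
  by_contra hne
  rw [Set.not_nonempty_iff_eq_empty] at hne
  have h0 : f =ᶠ[nhds x] 0 := by
    filter_upwards [hU.mem_nhds hx] with y hy
    by_contra hy0
    exact (Set.ext_iff.mp hne y).mp ⟨hy, hy0⟩
  have := hf.eqOn_zero_of_preconnected_of_eventuallyEq_zero isPreconnected_univ (Set.mem_univ x) h0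
  obtain ⟨y, hy⟩ := h
  exact hy (this (Set.mem_univ y))

/-- The quotient of two holomorphic functions that are not proportional to each other is not real
at a generic point. -/
theorem AnalyticOnNhd.dense_im_div_ne_zero {f h : E → ℂ} (hf : AnalyticOnNhd ℂ f Set.univ)
    (hh : AnalyticOnNhd ℂ h Set.univ) (h0 : ∃ x, h x ≠ 0) (hfh : ∀ c : ℂ, ∃ x, f x ≠ c * h x) :
    Dense {x | h x ≠ 0 ∧ (f x / h x).im ≠ 0} := by
  rw [dense_iff_inter_open]
  intro U hU hUne
  obtain ⟨x, hxU, hx⟩ := (hh.dense_ne_zero h0).inter_open_nonempty U hU hUne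
  have hopen : IsOpen (U ∩ {x | h x ≠ 0}) :=
    hU.inter (isOpen_ne_fun hh.continuous continuous_const)
  obtain ⟨ε, hε, hball⟩ := Metric.isOpen_iff.mp hopen x ⟨hxU, hx⟩
  by_contra hne
  rw [Set.not_nonempty_iff_eq_empty] at hne
  have him : ∀ y ∈ Metric.ball x ε, (f y / h y).im = 0 := by
    intro y hy
    by_contra hy0
    exact (Set.ext_iff.mp hne y).mp ⟨(hball hy).1, (hball hy).2, hy0⟩
  have hq : AnalyticOnNhd ℂ (fun y => f y / h y) (Metric.ball x ε) := fun y hy =>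
    (hf y (Set.mem_univ y)).div (hh y (Set.mem_univ y)) (hball hy).2
  -- Open mapping theorem: a non-constant quotient would take a value shifted from `f x / h x` by a
  -- small imaginary number, contrary to `him`.
  have hconst : ∃ c, ∀ y ∈ Metric.ball x ε, f y / h y = c := by
    rcases hq.is_constant_or_isOpen (convex_ball x ε).isPreconnected with hc | ho
    · exact hc
    · have ho := ho _ subset_rfl Metric.isOpen_ball
      obtain ⟨δ, hδ, hδball⟩ := Metric.isOpen_iff.mp ho _ ⟨x, Metric.mem_ball_self hε, rfl⟩
      obtain ⟨y, hy, hyeq⟩ := hδball (show f x / h x + (δ / 2 : ℝ) * Complex.I ∈ _ by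
        rw [Metric.mem_ball, dist_eq_norm, add_sub_cancel_left, norm_mul, Complex.norm_I, mul_one,
          Complex.norm_real, Real.norm_eq_abs, abs_of_pos (half_pos hδ)]
        exact half_lt_self hδ)
      have h1 := him y hy
      have h2 := him x (Metric.mem_ball_self hε)
      simp only at hyeq
      rw [hyeq] at h1
      simp [h2] at h1
      exact absurd h1 hδ.ne'
  obtain ⟨c, hc⟩ := hconst
  obtain ⟨y, hy⟩ := hfh c
  have heq : f =ᶠ[nhds x] fun y => c * h y := by
    filter_upwards [Metric.ball_mem_nhds x hε] with y hy
    rw [← hc y hy, div_mul_cancel₀ _ (hball hy).2]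
  exact hy (hf.eqOn_of_preconnected_of_eventuallyEq (analyticOnNhd_const.mul hh)
    isPreconnected_univ (Set.mem_univ x) heq (Set.mem_univ y))

/-- A point that is generic with respect to finitely many non-zero functions and finitely many
non-constant quotients. -/
theorem exists_generic {ι κ : Type*} [Finite ι] [Finite κ] [CompleteSpace E]
    (f : ι → E → ℂ) (hf : ∀ i, AnalyticOnNhd ℂ (f i) Set.univ) (hf0 : ∀ i, ∃ x, f i x ≠ 0)
    (a b : κ → E → ℂ) (ha : ∀ k, AnalyticOnNhd ℂ (a k) Set.univ)
    (hb : ∀ k, AnalyticOnNhd ℂ (b k) Set.univ) (hb0 : ∀ k, ∃ x, b k x ≠ 0)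
    (hab : ∀ k, ∀ c : ℂ, ∃ x, a k x ≠ c * b k x) :
    ∃ x, (∀ i, f i x ≠ 0) ∧ ∀ k, (a k x / b k x).im ≠ 0 := by
  have h1 : ∀ i, IsOpen {x | f i x ≠ 0} := fun i =>
    isOpen_ne_fun (hf i).continuous continuous_const
  have h2 : ∀ k, IsOpen {x | b k x ≠ 0 ∧ (a k x / b k x).im ≠ 0} := by
    intro k
    have hopen := isOpen_ne_fun (hb k).continuous (continuous_const (y := (0 : ℂ)))
    have hcont : ContinuousOn (fun x => (a k x / b k x).im) {x | b k x ≠ 0} :=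
      Complex.continuous_im.comp_continuousOn
        ((ha k).continuous.continuousOn.div (hb k).continuous.continuousOn fun x hx => hx)
    exact hcont.isOpen_inter_preimage hopen isOpen_ne
  have d1 := dense_iInter_of_isOpen h1 fun i => (hf i).dense_ne_zero (hf0 i)
  have d2 := dense_iInter_of_isOpen h2 fun k =>
    (ha k).dense_im_div_ne_zero (hb k) (hb0 k) (hab k)
  obtain ⟨x, hx⟩ := (d1.inter_of_isOpen_right d2 (isOpen_iInter_of_finite h2)).nonempty
  exact ⟨x, fun i => Set.mem_iInter.mp hx.1 i, fun k => (Set.mem_iInter.mp hx.2 k).2⟩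

end Generic

/-! ### The derivative of the dilogarithm -/

-- Differentiation under the integral sign cancels the `t` in the denominator and leaves `-1 / (1 -
-- t z)`, which has the elementary primitive `log (1 - t z) / z` in `t`. For non-real `z` the number
-- `1 - t z` stays in the slit plane for every real `t`, and compactness bounds the derivative near
-- `z₀`.
open MeasureTheory in
theorem hasDerivAt_dilog {z₀ : ℂ} (h : z₀.im ≠ 0) :
    HasDerivAt dilog (-Complex.log (1 - z₀) / z₀) z₀ := by
  have slit : ∀ (t : ℝ) (z : ℂ), z.im ≠ 0 → 1 - (t : ℂ) * z ∈ Complex.slitPlane := by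
    intro t z hz
    rw [Complex.mem_slitPlane_iff]
    by_cases ht : t = 0
    · left; simp [ht]
    · right; simp [ht, hz]
  have hne : ∀ (t : ℝ) (z : ℂ), z.im ≠ 0 → 1 - (t : ℂ) * z ≠ 0 := fun t z hz =>
    Complex.slitPlane_ne_zero (slit t z hz)
  have hz0 : z₀ ≠ 0 := by rintro rfl; simp at h
  have hopen : IsOpen {z : ℂ | z.im ≠ 0} := isOpen_ne_fun Complex.continuous_im continuous_const
  obtain ⟨ε, hε, hball⟩ := Metric.isOpen_iff.mp hopen z₀ h
  have hcball : Metric.closedBall z₀ (ε / 2) ⊆ {z : ℂ | z.im ≠ 0} :=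
    (Metric.closedBall_subset_ball (half_lt_self hε)).trans hball
  obtain ⟨C, hC⟩ := (isCompact_Icc (a := (0 : ℝ)) (b := 1)).prod
    (isCompact_closedBall z₀ (ε / 2)) |>.exists_bound_of_continuousOn
    (f := fun p : ℝ × ℂ => -(1 - (p.1 : ℂ) * p.2)⁻¹)
    (ContinuousOn.neg (ContinuousOn.inv₀ (by fun_prop) fun p hp => hne _ _ (hcball hp.2)))
  have hderiv : ∀ t : ℝ, HasDerivAt (fun s : ℝ => Complex.log (1 - (s : ℂ) * z₀))
      (-z₀ / (1 - (t : ℂ) * z₀)) t := by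
    intro t
    have h1 : HasDerivAt (fun s : ℝ => 1 - (s : ℂ) * z₀) (-z₀) t := by
      simpa using ((Complex.ofRealCLM.hasDerivAt (x := t)).mul_const z₀).const_sub 1
    exact h1.clog_real (slit t z₀ h)
  have hint : IntervalIntegrable (fun t : ℝ => Complex.log (1 - (t : ℂ) * z₀) / (t : ℂ)) volume
      0 1 := by
    -- The singularity at `t = 0` is removable, since the integrand is the difference quotient at
    -- `0` of `t ↦ log (1 - t z₀)`.
    have hcont : ContinuousOn (dslope (fun s : ℝ => Complex.log (1 - (s : ℂ) * z₀)) 0)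
        (Set.uIcc 0 1) := by
      refine ContinuousOn.mono ?_ (Set.subset_univ _)
      exact (continuousOn_dslope Filter.univ_mem).mpr
        ⟨fun t _ => (hderiv t).continuousAt.continuousWithinAt, (hderiv 0).differentiableAt⟩
    refine hcont.intervalIntegrable.congr ?_
    intro t ht
    rw [Set.uIoc_of_le zero_le_one] at ht
    rw [dslope_of_ne _ ht.1.ne', slope_def_module]
    simp [div_eq_inv_mul]
  have key := intervalIntegral.hasDerivAt_integral_of_dominated_loc_of_deriv_le (μ := volume)
    (a := 0) (b := 1)
    (F := fun (z : ℂ) (t : ℝ) => Complex.log (1 - (t : ℂ) * z) / (t : ℂ))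
    (F' := fun (z : ℂ) (t : ℝ) => -(1 - (t : ℂ) * z)⁻¹) (x₀ := z₀) (bound := fun _ => C)
    (Metric.closedBall_mem_nhds z₀ (half_pos hε))
    (Filter.Eventually.of_forall fun z => (by fun_prop : Measurable _).aestronglyMeasurable)
    hint ((by fun_prop : Measurable _).aestronglyMeasurable)
    (Filter.Eventually.of_forall fun t ht z hz => hC (t, z) ⟨by
      rw [Set.uIoc_of_le zero_le_one] at ht; exact ⟨ht.1.le, ht.2⟩, hz⟩)
    intervalIntegrable_const
    (Filter.Eventually.of_forall fun t ht z hz => by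
      rw [Set.uIoc_of_le zero_le_one] at ht
      have ht0 : (t : ℂ) ≠ 0 := by exact_mod_cast ht.1.ne'
      have h1 : HasDerivAt (fun z : ℂ => 1 - (t : ℂ) * z) (-(t : ℂ)) z := by
        simpa using ((hasDerivAt_id z).const_mul (t : ℂ)).const_sub 1
      have h2 := (h1.clog (slit t z (hcball hz))).div_const (t : ℂ)
      refine h2.congr_deriv ?_
      have := hne t z (hcball hz)
      field_simp)
  have hval : ∫ t in (0 : ℝ)..1, -(1 - (t : ℂ) * z₀)⁻¹ = Complex.log (1 - z₀) / z₀ := by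
    have := intervalIntegral.integral_eq_sub_of_hasDerivAt (a := 0) (b := 1)
      (f := fun t : ℝ => Complex.log (1 - (t : ℂ) * z₀) / z₀)
      (f' := fun t : ℝ => -(1 - (t : ℂ) * z₀)⁻¹)
      (fun t _ => by
        refine ((hderiv t).div_const z₀).congr_deriv ?_
        have := hne t z₀ h
        field_simp)
      (ContinuousOn.intervalIntegrable (ContinuousOn.neg
        (ContinuousOn.inv₀ (by fun_prop) fun t _ => hne _ _ h)))
    simpa using this
  have := key.2.neg
  rw [hval] at this
  refine this.congr_deriv ?_
  ring

/-! ### The critical equations -/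

/-- `f` has logarithmic derivative `ν` with respect to `log z`. -/
def HasLogDerivAt (f : ℂ → ℂ) (ν z₀ : ℂ) : Prop := HasDerivAt f (ν * f z₀ / z₀) z₀

namespace HasLogDerivAt

variable {f g : ℂ → ℂ} {ν κ z₀ : ℂ}

theorem mul (hf : HasLogDerivAt f ν z₀) (hg : HasLogDerivAt g κ z₀) :
    HasLogDerivAt (fun z => f z * g z) (ν + κ) z₀ := by
  have := HasDerivAt.fun_mul hf hg
  unfold HasLogDerivAt
  refine this.congr_deriv ?_
  ring

theorem div (hf : HasLogDerivAt f ν z₀) (hg : HasLogDerivAt g κ z₀) (h0 : g z₀ ≠ 0) :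
    HasLogDerivAt (fun z => f z / g z) (ν - κ) z₀ := by
  have := HasDerivAt.fun_div hf hg h0
  unfold HasLogDerivAt
  refine this.congr_deriv ?_
  field_simp

theorem const_mul (hf : HasLogDerivAt f ν z₀) (c : ℂ) : HasLogDerivAt (fun z => c * f z) ν z₀ := by
  have := HasDerivAt.const_mul c hf
  unfold HasLogDerivAt
  refine this.congr_deriv ?_
  ring

theorem clog (hf : HasLogDerivAt f ν z₀) (h : (f z₀).im ≠ 0) :
    HasDerivAt (fun z => Complex.log (f z)) (ν / z₀) z₀ := by
  have := HasDerivAt.clog hf (Complex.mem_slitPlane_iff.mpr (Or.inr h))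
  have h0 : f z₀ ≠ 0 := by intro h0; simp [h0] at h
  refine this.congr_deriv ?_
  field_simp

theorem dilog (hf : HasLogDerivAt f ν z₀) (h : (f z₀).im ≠ 0) :
    HasDerivAt (fun z => dilog (f z)) (-ν * Complex.log (1 - f z₀) / z₀) z₀ := by
  have := (hasDerivAt_dilog h).comp z₀ hf
  have h0 : f z₀ ≠ 0 := by intro h0; simp [h0] at h
  refine this.congr_deriv ?_
  field_simp

end HasLogDerivAt

theorem hasLogDerivAt_update {R : Type*} [DecidableEq R] (w : R → ℂ) (r r' : R) (hr : w r ≠ 0) :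
    HasLogDerivAt (fun z => Function.update w r z r') (if r' = r then 1 else 0) (w r) := by
  unfold HasLogDerivAt
  by_cases h : r' = r
  · subst h
    simpa [hr] using hasDerivAt_id' (w r')
  · simpa [h] using hasDerivAt_const (w r) (w r')

/-- The contribution of a positive crossing to the potential function. -/
noncomputable def positivePotential (wj wk wl wm a b : ℂ) : ℂ :=
  dilog (wm / (b * wj)) + dilog (wk / (a * wj)) - dilog (wl / (b * wk)) - dilog (wl / (a * wm))
    + dilog (wj * wl / (wm * wk)) - (Real.pi : ℂ) ^ 2 / 6
    + Complex.log (wm / (b * wj)) * Complex.log (wk / (a * wj))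

/-- The factors `exp (w ∂W/∂w)` of a positive crossing at its four corners. -/
noncomputable def positiveFactor (wj wk wl wm a b : ℂ) : Corner → ℂ
  | .south => (1 - wm / (b * wj)) * (1 - wk / (a * wj)) /
      ((1 - wj * wl / (wm * wk)) * (wm / (b * wj)) * (wk / (a * wj)))
  | .east => (1 - wj * wl / (wm * wk)) * (wm / (b * wj)) /
      ((1 - wk / (a * wj)) * (1 - wl / (b * wk)))
  | .north => (1 - wl / (b * wk)) * (1 - wl / (a * wm)) / (1 - wj * wl / (wm * wk))
  | .west => (1 - wj * wl / (wm * wk)) * (wk / (a * wj)) /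
      ((1 - wm / (b * wj)) * (1 - wl / (a * wm)))

/-- The five arguments of the dilogarithm at a positive crossing are not real. -/
def NonrealArguments (wj wk wl wm a b : ℂ) : Prop :=
  (wm / (b * wj)).im ≠ 0 ∧ (wk / (a * wj)).im ≠ 0 ∧ (wl / (b * wk)).im ≠ 0 ∧
    (wl / (a * wm)).im ≠ 0 ∧ (wj * wl / (wm * wk)).im ≠ 0

/-- The arguments are Laurent monomials in the region variables, so `z dW/dz` is an integer
combination of logarithms `log x` and `log (1 - x)`, and the exponential makes it a product of
powers of `x` and `1 - x`. The predicate `ν` marks the corners in the region being varied; one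
region may occupy several corners of the same crossing. -/
theorem exists_hasDerivAt_positivePotential {wj wk wl wm : ℂ → ℂ} {a b z₀ : ℂ} {ν : Corner → Prop}
    [DecidablePred ν]
    (hz₀ : z₀ ≠ 0) (hj : HasLogDerivAt wj (if ν .south then 1 else 0) z₀)
    (hk : HasLogDerivAt wk (if ν .east then 1 else 0) z₀)
    (hl : HasLogDerivAt wl (if ν .north then 1 else 0) z₀)
    (hm : HasLogDerivAt wm (if ν .west then 1 else 0) z₀)
    (h : NonrealArguments (wj z₀) (wk z₀) (wl z₀) (wm z₀) a b) :
    ∃ d, HasDerivAt (fun z => positivePotential (wj z) (wk z) (wl z) (wm z) a b) d z₀ ∧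
      Complex.exp (z₀ * d) = ∏ k : Corner,
        if ν k then positiveFactor (wj z₀) (wk z₀) (wl z₀) (wm z₀) a b k else 1 := by
  obtain ⟨h1, h2, h3, h4, h5⟩ := h
  have nz : ∀ {x : ℂ}, x.im ≠ 0 → x ≠ 0 := by rintro x hx rfl; simp at hx
  have nz1 : ∀ {x : ℂ}, x.im ≠ 0 → 1 - x ≠ 0 := by
    intro x hx h0
    rw [sub_eq_zero] at h0
    simp [← h0] at hx
  have d1 := hm.div (hj.const_mul b) (div_ne_zero_iff.mp (nz h1)).2
  have d2 := hk.div (hj.const_mul a) (div_ne_zero_iff.mp (nz h2)).2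
  have d3 := hl.div (hk.const_mul b) (div_ne_zero_iff.mp (nz h3)).2
  have d4 := hl.div (hm.const_mul a) (div_ne_zero_iff.mp (nz h4)).2
  have d5 := (hj.mul hl).div (hm.mul hk) (div_ne_zero_iff.mp (nz h5)).2
  refine ⟨_, (((((d1.dilog h1).add (d2.dilog h2)).sub (d3.dilog h3)).sub (d4.dilog h4)).add
    (d5.dilog h5)).sub_const ((Real.pi : ℂ) ^ 2 / 6) |>.add ((d1.clog h1).mul (d2.clog h2)), ?_⟩
  have e1 := Complex.exp_log (nz h1)
  have e2 := Complex.exp_log (nz h2)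
  have f1 := Complex.exp_log (nz1 h1)
  have f2 := Complex.exp_log (nz1 h2)
  have f3 := Complex.exp_log (nz1 h3)
  have f4 := Complex.exp_log (nz1 h4)
  have f5 := Complex.exp_log (nz1 h5)
  have hprod : ∀ φ : Corner → ℂ, ∏ k, φ k = φ .south * φ .east * φ .north * φ .west := by
    intro φ
    change ∏ k ∈ {Corner.south, Corner.east, Corner.north, Corner.west}, φ k = _
    simp [mul_assoc]
  -- Writing each corner factor as an exponential turns the claim into a linear identity between
  -- logarithms, with the indicators of `ν` as coefficients.
  have hc : ∀ (p : Prop) [Decidable p] (x y : ℂ), Complex.exp y = x →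
      (if p then x else 1) = Complex.exp ((if p then 1 else 0) * y) := by
    rintro p _ x y rfl
    split <;> simp
  rw [hprod]
  simp only [positiveFactor]
  rw [hc (ν .south) _ (Complex.log (1 - wm z₀ / (b * wj z₀)) + Complex.log (1 - wk z₀ / (a * wj z₀))
      - (Complex.log (1 - wj z₀ * wl z₀ / (wm z₀ * wk z₀)) + Complex.log (wm z₀ / (b * wj z₀))
        + Complex.log (wk z₀ / (a * wj z₀)))),
    hc (ν .east) _ (Complex.log (1 - wj z₀ * wl z₀ / (wm z₀ * wk z₀))
      + Complex.log (wm z₀ / (b * wj z₀))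
      - (Complex.log (1 - wk z₀ / (a * wj z₀)) + Complex.log (1 - wl z₀ / (b * wk z₀)))),
    hc (ν .north) _ (Complex.log (1 - wl z₀ / (b * wk z₀)) + Complex.log (1 - wl z₀ / (a * wm z₀))
      - Complex.log (1 - wj z₀ * wl z₀ / (wm z₀ * wk z₀))),
    hc (ν .west) _ (Complex.log (1 - wj z₀ * wl z₀ / (wm z₀ * wk z₀))
      + Complex.log (wk z₀ / (a * wj z₀))
      - (Complex.log (1 - wm z₀ / (b * wj z₀)) + Complex.log (1 - wl z₀ / (a * wm z₀)))),
    ← Complex.exp_add, ← Complex.exp_add, ← Complex.exp_add]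
  · congr 1
    field_simp
    ring
  · rw [Complex.exp_sub, Complex.exp_add, Complex.exp_add, e2, f1, f4, f5]
  · rw [Complex.exp_sub, Complex.exp_add, f3, f4, f5]
  · rw [Complex.exp_sub, Complex.exp_add, Complex.exp_add, e1, f2, f3, f5]
  · rw [Complex.exp_sub, Complex.exp_add, Complex.exp_add, Complex.exp_add, e1, e2, f1, f2, f5]

/-- The reflection of the corners that exchanges left and right. -/
def Corner.reflect : Corner → Corner
  | .south => .south
  | .east => .west
  | .north => .north
  | .west => .east

theorem Corner.reflect_involutive : Function.Involutive Corner.reflect := by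
  intro k; cases k <;> rfl

theorem positivePotential_reflect (wj wk wl wm a b : ℂ) :
    positivePotential wj wm wl wk b a = positivePotential wj wk wl wm a b := by
  unfold positivePotential
  rw [mul_comm wk wm]
  ring

/-! ### One set of formulas for both crossing signs. -/

namespace LinkDiagram

variable (D : LinkDiagram)

/-- `x` at a positive crossing, `x⁻¹` at a negative one. -/
def signed {G : Type*} [Inv G] (c : D.Crossing) (x : G) : G := if D.positive c then x else x⁻¹

/-- The identity at a positive crossing, the reflection at a negative one. -/
def orient (c : D.Crossing) (k : Corner) : Corner := if D.positive c then k else k.reflect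

theorem orient_involutive (c : D.Crossing) : Function.Involutive (D.orient c) := by
  intro k
  unfold orient
  split
  · rfl
  · exact Corner.reflect_involutive k

/-- The region variables at a crossing, up to reflection at a negative crossing. -/
def cornerVar (w : D.Region → ℂ) (c : D.Crossing) (k : Corner) : ℂ := w (D.region c (D.orient c k))

/-- The component variable of a strand, inverted at a negative crossing. -/
noncomputable def strandVar (m : D.Component → ℂ) (c : D.Crossing) (s : Strand) : ℂ :=
  D.signed c (m (D.component (D.outEdge c s)))

/-- A negative crossing is the mirror image of a positive one: left and right are exchanged, the
component variables are inverted and the potential changes sign. The analysis thus only has to treat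
the positive formula. -/
theorem crossingPotential_eq (w : D.Region → ℂ) (m : D.Component → ℂ) (c : D.Crossing) :
    D.crossingPotential w m c = (if D.positive c then 1 else -1) *
      positivePotential (D.cornerVar w c .south) (D.cornerVar w c .east) (D.cornerVar w c .north)
        (D.cornerVar w c .west) (D.strandVar m c .under) (D.strandVar m c .over) := by
  have hx : ∀ x y z : ℂ, y / (x⁻¹ * z) = x * y / z := by
    intro x y z
    simp only [div_eq_mul_inv, mul_inv, inv_inv]
    ring
  unfold crossingPotential cornerVar strandVar signed orient mα mβ GaussDiagram.upLeft
    GaussDiagram.upRight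
  split_ifs with h
  · simp [positivePotential]
  · simp only [Corner.reflect]
    rw [positivePotential_reflect]
    unfold positivePotential
    simp only [hx]
    ring

/-- The factors `exp (w ∂W/∂w)` at the corners of a crossing. -/
noncomputable def cornerFactor (w : D.Region → ℂ) (m : D.Component → ℂ) (c : D.Crossing)
    (k : Corner) : ℂ :=
  D.signed c (positiveFactor (D.cornerVar w c .south) (D.cornerVar w c .east)
    (D.cornerVar w c .north) (D.cornerVar w c .west) (D.strandVar m c .under)
    (D.strandVar m c .over) (D.orient c k))

-- The potential is a sum over crossings, so the exponential of its logarithmic derivative is a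
-- product of corner factors; the sign of a negative crossing inverts its factors. Non-real
-- arguments stay off all branch cuts, which gives differentiability.
open scoped Classical in
theorem isSolution_of_prod_cornerFactor (w : D.Region → ℂ) (m : D.Component → ℂ)
    (hw : ∀ r, w r ≠ 0)
    (harg : ∀ c, NonrealArguments (D.cornerVar w c .south) (D.cornerVar w c .east)
      (D.cornerVar w c .north) (D.cornerVar w c .west) (D.strandVar m c .under)
      (D.strandVar m c .over))
    (hprod : ∀ r, ∏ c : D.Crossing, ∏ k : Corner,
      (if D.region c k = r then D.cornerFactor w m c k else 1) = 1) :
    D.IsSolution w m := by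
  intro r
  have hd : ∀ c : D.Crossing, ∃ d,
      HasDerivAt (fun z => D.crossingPotential (Function.update w r z) m c) d (w r) ∧
      Complex.exp (w r * d) = ∏ k : Corner,
        if D.region c k = r then D.cornerFactor w m c k else 1 := by
    intro c
    obtain ⟨d, hd, hexp⟩ := exists_hasDerivAt_positivePotential
      (ν := fun k => D.region c (D.orient c k) = r) (hw r)
      (hasLogDerivAt_update w r (D.region c (D.orient c .south)) (hw r))
      (hasLogDerivAt_update w r (D.region c (D.orient c .east)) (hw r))
      (hasLogDerivAt_update w r (D.region c (D.orient c .north)) (hw r))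
      (hasLogDerivAt_update w r (D.region c (D.orient c .west)) (hw r))
      (by simp only [Function.update_eq_self]; exact harg c)
    simp only [Function.update_eq_self] at hexp
    simp only [crossingPotential_eq]
    refine ⟨_, hd.const_mul _, ?_⟩
    rw [← Equiv.prod_comp (D.orient_involutive c).toPerm]
    simp only [Function.Involutive.coe_toPerm, cornerFactor, (D.orient_involutive c) _, signed]
    split_ifs
    · rw [one_mul]
      exact hexp
    · rw [neg_one_mul, mul_neg, Complex.exp_neg, hexp, ← Finset.prod_inv_distrib]
      refine Finset.prod_congr rfl fun k _ => ?_
      split_ifs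
      · rfl
      · exact inv_one
  choose d hd hexp using hd
  have hsum : HasDerivAt (fun z => D.potential (Function.update w r z) m) (∑ c, d c) (w r) :=
    HasDerivAt.fun_sum fun c _ => hd c
  refine ⟨hsum.differentiableAt, ?_⟩
  rw [hsum.deriv, Finset.mul_sum, Complex.exp_sum, ← hprod r]
  exact Finset.prod_congr rfl fun c _ => hexp c

end LinkDiagram

/-! ### Brackets -/

theorem bracket_self (u : Fin 2 → ℂ) : bracket u u = 0 := by unfold bracket; ring

theorem bracket_swap (u v : Fin 2 → ℂ) : bracket u v = -bracket v u := by unfold bracket; ring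

theorem bracket_smul_left (a : ℂ) (u v : Fin 2 → ℂ) : bracket (a • u) v = a * bracket u v := by
  simp only [bracket, Pi.smul_apply, smul_eq_mul]; ring

theorem bracket_smul_right (a : ℂ) (u v : Fin 2 → ℂ) : bracket u (a • v) = a * bracket u v := by
  simp only [bracket, Pi.smul_apply, smul_eq_mul]; ring

/-- This three-term relation is the source of every identity between a cross-ratio `z` and `1 - z`
below. -/
theorem bracket_pluecker (a b c d : Fin 2 → ℂ) :
    bracket a b * bracket c d - bracket a c * bracket b d + bracket a d * bracket b c = 0 := by
  unfold bracket; ring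

theorem bracket_ne_zero_comm {u v : Fin 2 → ℂ} : bracket u v ≠ 0 ↔ bracket v u ≠ 0 := by
  rw [bracket_swap, neg_ne_zero]

theorem ne_zero_of_bracket_left {u v : Fin 2 → ℂ} (h : bracket u v ≠ 0) : u ≠ 0 := by
  rintro rfl; simp [bracket] at h

theorem ne_zero_of_bracket_right {u v : Fin 2 → ℂ} (h : bracket u v ≠ 0) : v ≠ 0 := by
  rintro rfl; simp [bracket] at h

theorem bracket_eq_zero_iff {u v : Fin 2 → ℂ} (hu : u ≠ 0) :
    bracket u v = 0 ↔ ∃ a : ℂ, v = a • u := by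
  constructor
  · intro h
    unfold bracket at h
    by_cases h0 : u 0 = 0
    · have h1 : u 1 ≠ 0 := by
        intro h1
        exact hu (by ext i; fin_cases i <;> simp [h0, h1])
      refine ⟨v 1 / u 1, ?_⟩
      have : v 0 = 0 := by simpa [h0, h1] using h
      ext i; fin_cases i <;> simp [h0, h1, this]
    · refine ⟨v 0 / u 0, ?_⟩
      ext i
      fin_cases i
      · simp [h0]
      · simp only [Fin.mk_one, Pi.smul_apply, smul_eq_mul]
        field_simp
        linear_combination h
  · rintro ⟨a, rfl⟩
    rw [bracket_smul_right, bracket_self, mul_zero]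

theorem exists_bracket_ne_zero {u : Fin 2 → ℂ} (hu : u ≠ 0) : ∃ v, bracket v u ≠ 0 := by
  by_contra! h
  apply hu
  have h0 := h ![0, 1]
  have h1 := h ![1, 0]
  simp [bracket] at h0 h1
  ext i; fin_cases i <;> simp [h0, h1]

/-- The ratio of two brackets with a vector depends only on the line of this vector. -/
theorem bracket_div_bracket_congr {u v : Fin 2 → ℂ} (hu : u ≠ 0) (hv : v ≠ 0)
    (h : bracket u v = 0) (x y : Fin 2 → ℂ) :
    bracket u x / bracket u y = bracket v x / bracket v y := by
  obtain ⟨a, rfl⟩ := (bracket_eq_zero_iff hu).mp h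
  have ha : a ≠ 0 := by rintro rfl; simp at hv
  rw [bracket_smul_left, bracket_smul_left, mul_div_mul_left _ _ ha]

theorem bracket_smul_smul (g : SL(2, ℂ)) (u v : Fin 2 → ℂ) :
    bracket (g • u) (g • v) = bracket u v := by
  have h := g.2
  rw [Matrix.det_fin_two] at h
  simp only [bracket, Matrix.SpecialLinearGroup.smul_def, Matrix.smul_eq_mulVec, Matrix.mulVec,
    dotProduct, Fin.sum_univ_two]
  linear_combination (u 0 * v 1 - u 1 * v 0) * h

theorem bracket_inv_smul_left (g : SL(2, ℂ)) (u v : Fin 2 → ℂ) :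
    bracket (g⁻¹ • u) v = bracket u (g • v) := by
  rw [← bracket_smul_smul g, smul_inv_smul]

theorem analyticOnNhd_bracket {f h : (Fin 2 → ℂ) → Fin 2 → ℂ}
    (hf : ∀ i, AnalyticOnNhd ℂ (fun x => f x i) Set.univ)
    (hh : ∀ i, AnalyticOnNhd ℂ (fun x => h x i) Set.univ) :
    AnalyticOnNhd ℂ (fun x => bracket (f x) (h x)) Set.univ :=
  ((hf 0).mul (hh 1)).sub ((hf 1).mul (hh 0))

theorem analyticOnNhd_coord (i : Fin 2) :
    AnalyticOnNhd ℂ (fun x : Fin 2 → ℂ => x i) Set.univ :=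
  (ContinuousLinearMap.proj (R := ℂ) (φ := fun _ : Fin 2 => ℂ) i).analyticOnNhd _

theorem analyticOnNhd_smul_coord (g : SL(2, ℂ)) (i : Fin 2) :
    AnalyticOnNhd ℂ (fun x : Fin 2 → ℂ => (g • x) i) Set.univ := by
  simp only [Matrix.SpecialLinearGroup.smul_def, Matrix.smul_eq_mulVec, Matrix.mulVec,
    dotProduct, Fin.sum_univ_two]
  exact (analyticOnNhd_const.mul (analyticOnNhd_coord 0)).add
    (analyticOnNhd_const.mul (analyticOnNhd_coord 1))

/-! ### Points of the projective line -/

namespace CP1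

theorem mk_eq_mk {u v : Fin 2 → ℂ} (hu : u ≠ 0) (hv : v ≠ 0) :
    (Projectivization.mk ℂ u hu : CP1) = Projectivization.mk ℂ v hv ↔ bracket u v = 0 := by
  rw [eq_comm, Projectivization.mk_eq_mk_iff', bracket_eq_zero_iff hu]
  exact exists_congr fun a => eq_comm

theorem eq_iff_bracket_rep (x y : CP1) : x = y ↔ bracket x.rep y.rep = 0 := by
  rw [← mk_eq_mk x.rep_nonzero y.rep_nonzero, Projectivization.mk_rep, Projectivization.mk_rep]

theorem crossRatio_mk {a b c d : Fin 2 → ℂ} (ha : a ≠ 0) (hb : b ≠ 0) (hc : c ≠ 0) (hd : d ≠ 0) :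
    crossRatio (Projectivization.mk ℂ a ha) (Projectivization.mk ℂ b hb)
      (Projectivization.mk ℂ c hc) (Projectivization.mk ℂ d hd) =
      bracket a d * bracket b c / (bracket a c * bracket b d) := by
  obtain ⟨ka, ea⟩ := Projectivization.exists_smul_eq_mk_rep ℂ a ha
  obtain ⟨kb, eb⟩ := Projectivization.exists_smul_eq_mk_rep ℂ b hb
  obtain ⟨kc, ec⟩ := Projectivization.exists_smul_eq_mk_rep ℂ c hc
  obtain ⟨kd, ed⟩ := Projectivization.exists_smul_eq_mk_rep ℂ d hd
  unfold crossRatio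
  simp only [← ea, ← eb, ← ec, ← ed, Units.smul_def, bracket_smul_left, bracket_smul_right]
  have h : (ka : ℂ) * kb * kc * kd ≠ 0 := by simp
  rw [← mul_div_mul_left (bracket a d * bracket b c) _ h]
  congr 1 <;> ring

theorem isIdealTetrahedron_mk {z : ℂ} {a b c d : Fin 2 → ℂ} (hab : bracket a b ≠ 0)
    (hac : bracket a c ≠ 0) (had : bracket a d ≠ 0) (hbc : bracket b c ≠ 0)
    (hbd : bracket b d ≠ 0) (hcd : bracket c d ≠ 0)
    (hz : bracket a d * bracket b c = z * (bracket a c * bracket b d)) (ha : a ≠ 0) (hb : b ≠ 0)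
    (hc : c ≠ 0) (hd : d ≠ 0) :
    IsIdealTetrahedron z (Projectivization.mk ℂ a ha) (Projectivization.mk ℂ b hb)
      (Projectivization.mk ℂ c hc) (Projectivization.mk ℂ d hd) := by
  simp only [IsIdealTetrahedron, ne_eq, mk_eq_mk, crossRatio_mk]
  exact ⟨hab, hac, had, hbc, hbd, hcd, by rw [hz, mul_div_cancel_right₀ _ (mul_ne_zero hac hbd)]⟩

theorem coe_smul_mk (g : SL(2, ℂ)) {v : Fin 2 → ℂ} (hv : v ≠ 0) :
    (g : PSL(2, ℂ)) • (Projectivization.mk ℂ v hv : CP1) =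
      Projectivization.mk ℂ (g • v) ((smul_ne_zero_iff_ne g).mpr hv) := rfl

theorem crossRatio_smul (g : PSL(2, ℂ)) (x y z t : CP1) :
    crossRatio (g • x) (g • y) (g • z) (g • t) = crossRatio x y z t := by
  induction g using QuotientGroup.induction_on with
  | H g =>
  induction x using Projectivization.ind with | _ a ha =>
  induction y using Projectivization.ind with | _ b hb =>
  induction z using Projectivization.ind with | _ c hc =>
  induction t using Projectivization.ind with | _ d hd =>
  simp only [coe_smul_mk, crossRatio_mk, bracket_smul_smul]

/-- A matrix that fixes every line is trivial in `PSL(2, ℂ)`. -/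
theorem coe_eq_one_of_bracket {g : SL(2, ℂ)} (h : ∀ v, bracket v (g • v) = 0) :
    (g : PSL(2, ℂ)) = 1 := by
  refine eq_of_smul_eq_smul (α := CP1) fun x => ?_
  induction x using Projectivization.ind with | _ v hv =>
  rw [coe_smul_mk, one_smul, eq_comm, mk_eq_mk]
  exact h v

theorem exists_bracket_smul_ne_zero {g : SL(2, ℂ)} (hg : (g : PSL(2, ℂ)) ≠ 1) :
    ∃ v, bracket v (g • v) ≠ 0 := by
  by_contra! h
  exact hg (coe_eq_one_of_bracket h)

/-- The eigenlines of a non-central matrix are one-dimensional. -/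
theorem bracket_eq_zero_of_eigen {g : SL(2, ℂ)} (hg : (g : PSL(2, ℂ)) ≠ 1) {l : ℂ}
    {u v : Fin 2 → ℂ} (hu : g • u = l • u) (hv : g • v = l • v) : bracket u v = 0 := by
  by_contra h
  apply hg
  refine coe_eq_one_of_bracket fun x => ?_
  have hx : bracket u v • x = bracket x v • u + bracket u x • v := by
    ext i; fin_cases i <;> simp [bracket] <;> ring
  have hgx : bracket u v • (g • x) = bracket u v • (l • x) := by
    rw [smul_comm _ l, ← smul_comm g, hx, smul_add, smul_add, smul_comm g, smul_comm g, hu, hv,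
      smul_comm l, smul_comm l]
  have := smul_right_injective _ h hgx
  rw [this, bracket_smul_right, bracket_self, mul_zero]

/-- Because the determinant is `1`, `hl` is the characteristic equation of `g`. -/
theorem exists_eigenvector (g : SL(2, ℂ)) {l : ℂ} (hl : l ^ 2 - g.1.trace * l + 1 = 0) :
    ∃ v : Fin 2 → ℂ, v ≠ 0 ∧ g • v = l • v := by
  have hdet := g.2
  rw [Matrix.det_fin_two] at hdet
  obtain ⟨v, hv, h⟩ := Matrix.exists_mulVec_eq_zero_iff.mpr
    (show (g.1 - l • (1 : Matrix (Fin 2) (Fin 2) ℂ)).det = 0 by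
      rw [Matrix.trace_fin_two] at hl
      rw [Matrix.det_fin_two]
      simp
      linear_combination hl + hdet)
  refine ⟨v, hv, ?_⟩
  rw [Matrix.sub_mulVec, Matrix.smul_mulVec, Matrix.one_mulVec, sub_eq_zero] at h
  exact h

theorem exists_charpoly_root (t : ℂ) : ∃ l : ℂ, l ^ 2 - t * l + 1 = 0 := by
  obtain ⟨s, hs⟩ := IsAlgClosed.exists_eq_mul_self (t ^ 2 - 4)
  exact ⟨(t + s) / 2, by linear_combination -hs / 4⟩

end CP1

/-! ### Octahedra -/

/-- Used to bring the tetrahedra of both crossing signs into a common vertex order. -/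
theorem isIdealTetrahedron_inv_iff {z : ℂ} {a b c d : CP1} :
    IsIdealTetrahedron z⁻¹ a b d c ↔ IsIdealTetrahedron z a b c d := by
  have h : crossRatio a b d c = (crossRatio a b c d)⁻¹ := by
    unfold crossRatio
    rw [inv_div]
  unfold IsIdealTetrahedron
  rw [h, inv_inj, ne_comm (a := d)]
  tauto

/-- The octahedron with vertices `o`, `u` at the two strands, `p`, `p'` above and `q`, `q'` below
the diagram, is developed to five ideal tetrahedra with the given cross-ratios. -/
def IsOctahedron (z₁ z₂ z₃ z₄ z₅ : ℂ) (o u p p' q q' : CP1) : Prop :=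
  IsIdealTetrahedron z₁ o q p' p ∧ IsIdealTetrahedron z₂ u p q' q ∧
    IsIdealTetrahedron z₃ o q' p' p ∧ IsIdealTetrahedron z₄ u p' q' q ∧
    IsIdealTetrahedron z₅ p p' q' q

/-- After reflection and inversion at negative crossings, both signs give the same octahedron, whose
five cross-ratios are the arguments of `positivePotential`. -/
theorem LinkDiagram.DevelopingMap.hasShape_iff {D : LinkDiagram} {ρ : D.LinkGroup →* PSL(2, ℂ)}
    (d : D.DevelopingMap ρ) (w : D.Region → ℂ) (m : D.Component → ℂ) :
    d.HasShape w m ↔ ∀ c : D.Crossing, IsOctahedron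
      (D.cornerVar w c .west / (D.strandVar m c .over * D.cornerVar w c .south))
      (D.cornerVar w c .east / (D.strandVar m c .under * D.cornerVar w c .south))
      (D.cornerVar w c .north / (D.strandVar m c .over * D.cornerVar w c .east))
      (D.cornerVar w c .north / (D.strandVar m c .under * D.cornerVar w c .west))
      (D.cornerVar w c .south * D.cornerVar w c .north /
        (D.cornerVar w c .west * D.cornerVar w c .east))
      (d.cusp (D.outEdge c .over)) (d.cusp (D.inEdge c .under)) d.top
      (D.signed c (ρ (D.meridian (D.outEdge c .over))) • d.top)
      (d.bottom (D.region c .south)) (d.bottom (D.region c (D.orient c .east))) := by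
  unfold HasShape IsOctahedron
  refine forall_congr' fun c => ?_
  have swap : ∀ {z z' : ℂ} {x y s t : CP1}, z' = z⁻¹ →
      (IsIdealTetrahedron z' x y t s ↔ IsIdealTetrahedron z x y s t) := by
    rintro z _ x y s t rfl
    exact isIdealTetrahedron_inv_iff
  simp only [cornerVar, strandVar, signed, orient, mα, mβ, GaussDiagram.upLeft,
    GaussDiagram.upRight]
  split_ifs with h
  · rw [swap (z := w (D.region c .north) /
        (m (D.component (D.outEdge c .over)) * w (D.region c .east))) (inv_div _ _).symm,
      swap (z := w (D.region c .north) /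
        (m (D.component (D.outEdge c .under)) * w (D.region c .west))) (inv_div _ _).symm]
    tauto
  · simp only [Corner.reflect]
    have hx : ∀ x y z : ℂ, z / (x * y) = (y / (x⁻¹ * z))⁻¹ := by
      intro x y z
      simp only [div_eq_mul_inv, mul_inv, inv_inv]
      ring
    have hy : ∀ x y z : ℂ, x * y / z = y / (x⁻¹ * z) := by
      intro x y z
      simp only [div_eq_mul_inv, mul_inv, inv_inv]
      ring
    rw [swap (hx (m (D.component (D.outEdge c .over))) (w (D.region c .east)) _),
      swap (hx (m (D.component (D.outEdge c .under))) (w (D.region c .west)) _),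
      hy _ _ (w (D.region c .west)), hy _ _ (w (D.region c .east)),
      swap (z := w (D.region c .south) * w (D.region c .north) /
        (w (D.region c .east) * w (D.region c .west)))
        (z' := w (D.region c .west) * w (D.region c .east) /
          (w (D.region c .south) * w (D.region c .north)))
        (by rw [inv_div, mul_comm (w (D.region c .west))])]
    tauto

/-! ### The algebra of a crossing -/

/-- Developed vectors at a crossing: `p` above the diagram, `o` at the over-strand, `u` at the
incoming under-strand, `S`, `A`, `N`, `B` below the diagram, seen through the four corners. -/
structure CrossingVectors (p o u S A N B : Fin 2 → ℂ) (g k : SL(2, ℂ)) (l κ : ℂ) : Prop where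
  south : S = g • B
  east : A = g • N
  east' : A = k • S
  eigen_over : g • o = l • o
  eigen_under : k • u = κ • u
  l_ne : l ≠ 0
  κ_ne : κ ≠ 0
  o_ne : o ≠ 0
  u_ne : u ≠ 0
  top : bracket p (g • p) ≠ 0
  top' : bracket p (k • p) ≠ 0
  under_top : bracket u (g • p) ≠ 0
  wS : bracket p S ≠ 0
  wA : bracket p A ≠ 0
  wN : bracket p N ≠ 0
  wB : bracket p B ≠ 0
  BS : bracket B S ≠ 0
  NA : bracket N A ≠ 0
  SA : bracket S A ≠ 0

/-- If `x` lay on the eigenline of `o`, then `g • x` would be parallel to `x`. Genericity with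
respect to the meridians thus implies genericity with respect to all eigenvectors. -/
theorem bracket_eigen_ne_zero {g : SL(2, ℂ)} {l : ℂ} {o x : Fin 2 → ℂ} (ho : o ≠ 0)
    (h : g • o = l • o) (hx : bracket x (g • x) ≠ 0) : bracket o x ≠ 0 := by
  intro h0
  obtain ⟨a, rfl⟩ := (bracket_eq_zero_iff ho).mp h0
  apply hx
  rw [smul_comm g a, h, smul_smul, bracket_smul_left, bracket_smul_right, bracket_self]
  simp

/-- The matrix preserves brackets and scales `o` by `l`. This is how the component variables `l⁻¹`
enter the cross-ratios. -/
theorem bracket_eigen_smul {g : SL(2, ℂ)} {l : ℂ} {o : Fin 2 → ℂ} (hl : l ≠ 0)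
    (h : g • o = l • o) (x : Fin 2 → ℂ) : bracket o (g • x) = l⁻¹ * bracket o x := by
  have := bracket_smul_smul g o x
  rw [h, bracket_smul_left] at this
  rw [← this, inv_mul_cancel_left₀ hl]

namespace CrossingVectors

variable {p o u S A N B : Fin 2 → ℂ} {g k : SL(2, ℂ)} {l κ : ℂ}
  (h : CrossingVectors p o u S A N B g k l κ)

include h

theorem p_ne : p ≠ 0 := ne_zero_of_bracket_left h.top
theorem S_ne : S ≠ 0 := ne_zero_of_bracket_left h.SA
theorem A_ne : A ≠ 0 := ne_zero_of_bracket_right h.SA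

theorem op : bracket o p ≠ 0 := bracket_eigen_ne_zero h.o_ne h.eigen_over h.top
theorem up : bracket u p ≠ 0 := bracket_eigen_ne_zero h.u_ne h.eigen_under h.top'
theorem oB : bracket o B ≠ 0 :=
  bracket_eigen_ne_zero h.o_ne h.eigen_over (by rw [← h.south]; exact h.BS)
theorem oN : bracket o N ≠ 0 :=
  bracket_eigen_ne_zero h.o_ne h.eigen_over (by rw [← h.east]; exact h.NA)
theorem uS : bracket u S ≠ 0 :=
  bracket_eigen_ne_zero h.u_ne h.eigen_under (by rw [← h.east']; exact h.SA)

theorem op' : bracket o (g • p) = l⁻¹ * bracket o p := bracket_eigen_smul h.l_ne h.eigen_over p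
theorem oS : bracket o S = l⁻¹ * bracket o B := by
  rw [h.south, bracket_eigen_smul h.l_ne h.eigen_over]
theorem oA : bracket o A = l⁻¹ * bracket o N := by
  rw [h.east, bracket_eigen_smul h.l_ne h.eigen_over]
theorem uA : bracket u A = κ⁻¹ * bracket u S := by
  rw [h.east', bracket_eigen_smul h.κ_ne h.eigen_under]
theorem p'S : bracket (g • p) S = bracket p B := by rw [h.south, bracket_smul_smul]
theorem p'A : bracket (g • p) A = bracket p N := by rw [h.east, bracket_smul_smul]

/-- Equivariance reduces `bracket (g • p) S` and `bracket (g • p) A` to `bracket p B` and `bracket p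
N`. In the outer tetrahedra the brackets with the eigenvector cancel up to an eigenvalue. -/
theorem isOctahedron :
    IsOctahedron (bracket p B / (l⁻¹ * bracket p S)) (bracket p A / (κ⁻¹ * bracket p S))
      (bracket p N / (l⁻¹ * bracket p A)) (bracket p N / (κ⁻¹ * bracket p B))
      (bracket p S * bracket p N / (bracket p B * bracket p A))
      (Projectivization.mk ℂ o h.o_ne) (Projectivization.mk ℂ u h.u_ne)
      (Projectivization.mk ℂ p h.p_ne) ((g : PSL(2, ℂ)) • Projectivization.mk ℂ p h.p_ne)
      (Projectivization.mk ℂ S h.S_ne) (Projectivization.mk ℂ A h.A_ne) := by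
  have hl := h.l_ne
  have hκ := h.κ_ne
  have wS := h.wS
  have wA := h.wA
  have wN := h.wN
  have wB := h.wB
  have hpS := bracket_swap S p
  have hp'S := bracket_swap S (g • p)
  have hpA := bracket_swap A p
  have hp'A := bracket_swap A (g • p)
  have hp'p := bracket_swap (g • p) p
  have hAS := bracket_swap A S
  have hop' := h.op'
  have huA := h.uA
  rw [h.p'S] at hp'S
  rw [h.p'A] at hp'A
  have n1 : bracket o (g • p) ≠ 0 := by rw [h.op']; exact mul_ne_zero (inv_ne_zero hl) h.op
  have n2 : bracket o S ≠ 0 := by rw [h.oS]; exact mul_ne_zero (inv_ne_zero hl) h.oB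
  have n3 : bracket o A ≠ 0 := by rw [h.oA]; exact mul_ne_zero (inv_ne_zero hl) h.oN
  have n4 : bracket u A ≠ 0 := by rw [h.uA]; exact mul_ne_zero (inv_ne_zero hκ) h.uS
  have n5 : bracket (g • p) S ≠ 0 := by rw [h.p'S]; exact wB
  have n6 : bracket (g • p) A ≠ 0 := by rw [h.p'A]; exact wN
  rw [CP1.coe_smul_mk]
  refine ⟨CP1.isIdealTetrahedron_mk n2 n1 h.op (bracket_ne_zero_comm.mp n5)
      (bracket_ne_zero_comm.mp wS) (bracket_ne_zero_comm.mp h.top) ?_ _ _ _ _,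
    CP1.isIdealTetrahedron_mk h.up n4 h.uS wA wS (bracket_ne_zero_comm.mp h.SA) ?_ _ _ _ _,
    CP1.isIdealTetrahedron_mk n3 n1 h.op (bracket_ne_zero_comm.mp n6)
      (bracket_ne_zero_comm.mp wA) (bracket_ne_zero_comm.mp h.top) ?_ _ _ _ _,
    CP1.isIdealTetrahedron_mk h.under_top n4 h.uS n6 n5 (bracket_ne_zero_comm.mp h.SA) ?_ _ _ _ _,
    CP1.isIdealTetrahedron_mk h.top wA wS n6 n5 (bracket_ne_zero_comm.mp h.SA) ?_ _ _ _ _⟩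
  · rw [hop', hp'S, hpS]; field_simp
  · rw [huA]; field_simp
  · rw [hop', hp'A, hpA]; field_simp
  · rw [huA, h.p'S, h.p'A]; field_simp
  · rw [h.p'S, h.p'A]; field_simp

/-- The Plücker relation for the four vertices of the tetrahedron. This lemma and its four analogues
express `1 - z` as a monomial in brackets and eigenvalues, so that the critical equations can
factor. -/
theorem one_sub₁ : 1 - bracket p B / (l⁻¹ * bracket p S) =
    bracket o B * bracket p (g • p) / (bracket o p * bracket p S) := by
  have hP := bracket_pluecker o p (g • p) S
  have wS := h.wS
  have hl := h.l_ne
  have hop := h.op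
  rw [h.op', h.oS, h.p'S] at hP
  field_simp at hP ⊢
  linear_combination -hP

theorem one_sub₂ : 1 - bracket p A / (κ⁻¹ * bracket p S) =
    -(κ * bracket u p * bracket S A / (bracket u S * bracket p S)) := by
  have hP := bracket_pluecker u p S A
  have wS := h.wS
  have hκ := h.κ_ne
  have huS := h.uS
  rw [h.uA] at hP
  field_simp at hP ⊢
  linear_combination hP

theorem one_sub₃ : 1 - bracket p N / (l⁻¹ * bracket p A) =
    bracket o N * bracket p (g • p) / (bracket o p * bracket p A) := by
  have hP := bracket_pluecker o p (g • p) A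
  have wA := h.wA
  have hl := h.l_ne
  have hop := h.op
  rw [h.op', h.oA, h.p'A] at hP
  field_simp at hP ⊢
  linear_combination -hP

theorem one_sub₄ : 1 - bracket p N / (κ⁻¹ * bracket p B) =
    -(κ * bracket u (g • p) * bracket S A / (bracket u S * bracket p B)) := by
  have hP := bracket_pluecker u (g • p) S A
  have wB := h.wB
  have hκ := h.κ_ne
  have huS := h.uS
  rw [h.uA, h.p'S, h.p'A] at hP
  field_simp at hP ⊢
  linear_combination hP

theorem one_sub₅ : 1 - bracket p S * bracket p N / (bracket p B * bracket p A) =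
    -(bracket p (g • p) * bracket S A / (bracket p B * bracket p A)) := by
  have hP := bracket_pluecker p (g • p) S A
  have wB := h.wB
  have wA := h.wA
  rw [h.p'S, h.p'A] at hP
  field_simp at hP ⊢
  linear_combination hP

/-- The factors of the critical equations at a crossing split into factors at the half-edges. -/
theorem positiveFactor_eq (i : Corner) : positiveFactor (bracket p S) (bracket p A) (bracket p N)
    (bracket p B) κ⁻¹ l⁻¹ i = match i with
      | .south => bracket o S / bracket o p / (bracket u S / bracket u p)
      | .east => bracket u A / bracket u p / (bracket o A / bracket o p)
      | .north => bracket o N / bracket o p /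
          (bracket (g⁻¹ • u) N / bracket (g⁻¹ • u) p)
      | .west => bracket (g⁻¹ • u) B / bracket (g⁻¹ • u) p /
          (bracket o B / bracket o p) := by
  have wS := h.wS
  have wA := h.wA
  have wN := h.wN
  have wB := h.wB
  have hl := h.l_ne
  have hκ := h.κ_ne
  have hop := h.op
  have hup := h.up
  have hoB := h.oB
  have hoN := h.oN
  have huS := h.uS
  have hup' := h.under_top
  have hSA := h.SA
  have htop := h.top
  -- The brackets `bracket p (g • p)` and `bracket S A` of the two inner edges cancel in all four
  -- factors. What remains belongs to the strands; `g⁻¹ • u` stands for the outgoing under-strand.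
  cases i <;> simp only [positiveFactor, h.one_sub₁, h.one_sub₂, h.one_sub₃, h.one_sub₄, h.one_sub₅,
    bracket_inv_smul_left, ← h.south, ← h.east, h.oS, h.oA, h.uA] <;> field_simp

end CrossingVectors

/-! ### Regions and meridians at a crossing -/

namespace GaussDiagram

variable (D : GaussDiagram)

theorem sides_of_positive {c : D.Crossing} (h : D.positive c = true) :
    D.leftRegion (D.inEdge c .over) = D.region c .west ∧
    D.rightRegion (D.inEdge c .over) = D.region c .south ∧
    D.leftRegion (D.inEdge c .under) = D.region c .south ∧
    D.rightRegion (D.inEdge c .under) = D.region c .east ∧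
    D.leftRegion (D.outEdge c .over) = D.region c .north ∧
    D.rightRegion (D.outEdge c .over) = D.region c .east ∧
    D.leftRegion (D.outEdge c .under) = D.region c .west ∧
    D.rightRegion (D.outEdge c .under) = D.region c .north := by
  simp [leftRegion_inEdge, rightRegion_inEdge, leftRegion_outEdge, rightRegion_outEdge, inLeft,
    inRight, outLeft, outRight, upRight, h]

theorem sides_of_negative {c : D.Crossing} (h : ¬ D.positive c = true) :
    D.leftRegion (D.inEdge c .over) = D.region c .south ∧
    D.rightRegion (D.inEdge c .over) = D.region c .east ∧
    D.leftRegion (D.inEdge c .under) = D.region c .west ∧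
    D.rightRegion (D.inEdge c .under) = D.region c .south ∧
    D.leftRegion (D.outEdge c .over) = D.region c .west ∧
    D.rightRegion (D.outEdge c .over) = D.region c .north ∧
    D.leftRegion (D.outEdge c .under) = D.region c .north ∧
    D.rightRegion (D.outEdge c .under) = D.region c .east := by
  simp [leftRegion_inEdge, rightRegion_inEdge, leftRegion_outEdge, rightRegion_outEdge, inLeft,
    inRight, outLeft, outRight, upRight, h]

theorem component_inEdge (c : D.Crossing) (s : Strand) :
    D.component (D.inEdge c s) = D.component (D.outEdge c s) :=
  Quotient.sound (show Equiv.Perm.SameCycle D.next _ _ from ⟨1, by simp [inEdge, outEdge]⟩)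

/-- Induction along a component. -/
theorem component_induction {P : D.Edge → Prop} (h : ∀ c s, P (D.inEdge c s) → P (D.outEdge c s))
    {e e' : D.Edge} (he : D.component e = D.component e') (h0 : P e) : P e' := by
  classical
  -- On a finite set the cycle is reached by non-negative powers, so forward steps suffice.
  obtain ⟨n, -, hn⟩ := Equiv.Perm.SameCycle.exists_pow_eq' (Quotient.exact he :
    Equiv.Perm.SameCycle D.next e e')
  have : ∀ n : ℕ, P ((D.next ^ n) e) := by
    intro n
    induction n with
    | zero => exact h0
    | succ n ih =>
      rw [pow_succ', Equiv.Perm.mul_apply]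
      refine h (D.next ((D.next ^ n) e)).1 (D.next ((D.next ^ n) e)).2 ?_
      rwa [inEdge_next]
  exact hn ▸ this n

end GaussDiagram

namespace LinkDiagram

open GaussDiagram

variable (D : LinkDiagram)

@[simp] theorem orient_south (c : D.Crossing) : D.orient c .south = .south := by
  unfold orient; split <;> rfl

@[simp] theorem orient_north (c : D.Crossing) : D.orient c .north = .north := by
  unfold orient; split <;> rfl

theorem signed_inv (c : D.Crossing) {G : Type*} [DivisionMonoid G] (x : G) :
    D.signed c x⁻¹ = (D.signed c x)⁻¹ := by
  unfold signed; split <;> rfl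

theorem map_signed (c : D.Crossing) {G H : Type*} [Group G] [Group H] (φ : G →* H) (x : G) :
    φ (D.signed c x) = D.signed c (φ x) := by
  unfold signed; split
  · rfl
  · exact map_inv φ x

theorem meridian_over (c : D.Crossing) :
    D.meridian (D.inEdge c .over) = D.meridian (D.outEdge c .over) := by
  have := PresentedGroup.one_of_mem (rels := {r | D.IsWirtingerRelator r})
    (IsWirtingerRelator.over c)
  rw [map_mul, map_inv, mul_inv_eq_one] at this
  exact this

/-- The Wirtinger relation in one form for both signs: the outgoing under-meridian is the incoming
one conjugated by the signed over-meridian. -/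
theorem meridian_under (c : D.Crossing) :
    D.meridian (D.inEdge c .under) * D.signed c (D.meridian (D.outEdge c .over)) =
      D.signed c (D.meridian (D.outEdge c .over)) * D.meridian (D.outEdge c .under) := by
  unfold signed
  split_ifs with h
  · have := PresentedGroup.one_of_mem (rels := {r | D.IsWirtingerRelator r})
      (IsWirtingerRelator.under_pos c h)
    rw [map_mul, map_mul, map_mul, map_inv, map_inv, mul_inv_eq_one, mul_assoc,
      inv_mul_eq_iff_eq_mul] at this
    exact this
  · have := PresentedGroup.one_of_mem (rels := {r | D.IsWirtingerRelator r})
      (IsWirtingerRelator.under_neg c (by simpa using h))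
    rw [map_mul, map_mul, map_mul, map_inv, map_inv, mul_inv_eq_one] at this
    rw [eq_inv_mul_iff_mul_eq, ← mul_assoc]
    exact this

/-- The Wirtinger relations say that a small loop around a crossing is trivial. -/
theorem isFlat_meridian {Γ : Type*} [Group Γ] (φ : D.LinkGroup →* Γ) :
    D.IsFlat fun e => φ (D.meridian e) := by
  intro c
  have h := D.meridian_under c
  have h' := D.meridian_over c
  simp only [← map_mul]
  congr 1
  unfold signed at h
  unfold upLeft upRight
  split_ifs at h ⊢
  · rw [h', h]
  · rw [h', mul_inv_eq_iff_eq_mul.mp h]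
    group

section Coloring

variable {X : Type*} {Γ : Type*} [Group Γ] [MulAction Γ X] {φ : D.LinkGroup →* Γ}
  {q : D.Region → X} (hq : ∀ e, q (D.rightRegion e) = φ (D.meridian e) • q (D.leftRegion e))
  (c : D.Crossing)

include hq

/-- At a negative crossing the sides of the strand are exchanged; `orient` accounts for the exchange
and `signed` for the inverse meridian. The next two lemmas work in the same way. -/
theorem coloring_over_in : q (D.region c .south) =
    D.signed c (φ (D.meridian (D.outEdge c .over))) • q (D.region c (D.orient c .west)) := by
  have h := hq (D.inEdge c .over)
  rw [meridian_over] at h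
  unfold signed orient
  split_ifs with hc
  · obtain ⟨h1, h2, -⟩ := D.sides_of_positive hc
    rwa [h1, h2] at h
  · obtain ⟨h1, h2, -⟩ := D.sides_of_negative hc
    rw [h1, h2] at h
    exact eq_inv_smul_iff.mpr h.symm

theorem coloring_under_in : q (D.region c (D.orient c .east)) =
    D.signed c (φ (D.meridian (D.inEdge c .under))) • q (D.region c .south) := by
  have h := hq (D.inEdge c .under)
  unfold signed orient
  split_ifs with hc
  · obtain ⟨-, -, h1, h2, -⟩ := D.sides_of_positive hc
    rwa [h1, h2] at h
  · obtain ⟨-, -, h1, h2, -⟩ := D.sides_of_negative hc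
    rw [h1, h2] at h
    exact eq_inv_smul_iff.mpr h.symm

theorem coloring_over_out : q (D.region c (D.orient c .east)) =
    D.signed c (φ (D.meridian (D.outEdge c .over))) • q (D.region c .north) := by
  have h := hq (D.outEdge c .over)
  unfold signed orient
  split_ifs with hc
  · obtain ⟨-, -, -, -, h1, h2, -⟩ := D.sides_of_positive hc
    rwa [h1, h2] at h
  · obtain ⟨-, -, -, -, h1, h2, -⟩ := D.sides_of_negative hc
    rw [h1, h2] at h
    exact eq_inv_smul_iff.mpr h.symm

end Coloring

/-! ### Products over the corners -/

theorem prod_strand {M : Type*} [CommMonoid M] (f : Strand → M) (c : D.Crossing) :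
    ∏ s, f s = f (D.upRight c) * f (D.upLeft c) := by
  change ∏ s ∈ {Strand.over, Strand.under}, f s = _
  rw [Finset.prod_pair (by decide)]
  unfold upRight upLeft
  split
  · rfl
  · exact mul_comm _ _

open scoped Classical in
/-- Corner factors that split into contributions of the two adjacent half-edges cancel around
every region. -/
theorem prod_corner_eq_one (φ : D.Crossing → Corner → ℂ) (x y : D.Edge → ℂ)
    (hx : ∀ e, x e ≠ 0) (hy : ∀ e, y e ≠ 0)
    (hS : ∀ c, φ c .south = y (D.inEdge c (D.upRight c)) / x (D.inEdge c (D.upLeft c)))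
    (hE : ∀ c, φ c .east = y (D.inEdge c (D.upLeft c)) / y (D.outEdge c (D.upRight c)))
    (hN : ∀ c, φ c .north = x (D.outEdge c (D.upRight c)) / y (D.outEdge c (D.upLeft c)))
    (hW : ∀ c, φ c .west = x (D.outEdge c (D.upLeft c)) / x (D.inEdge c (D.upRight c)))
    (r : D.Region) :
    ∏ c : D.Crossing, ∏ k : Corner, (if D.region c k = r then φ c k else 1) = 1 := by
  -- Regrouped by half-edges, a crossing contributes the product of `z` over its incoming edges
  -- divided by that over its outgoing edges. Every edge comes in once and goes out once, so the
  -- total is `1`.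
  set z : D.Edge → ℂ := fun e => (if D.rightRegion e = r then y e else 1) /
    (if D.leftRegion e = r then x e else 1) with hz
  have hz0 : ∀ e, z e ≠ 0 := by
    intro e
    apply div_ne_zero <;> split_ifs <;> simp [hx, hy]
  have hc : ∀ c : D.Crossing, ∏ k : Corner, (if D.region c k = r then φ c k else 1) =
      (∏ s, z (D.inEdge c s)) / ∏ s, z (D.outEdge c s) := by
    intro c
    rw [D.prod_strand _ c, D.prod_strand _ c]
    change ∏ k ∈ {Corner.south, Corner.east, Corner.north, Corner.west}, _ = _
    have ite_div : ∀ (p : Prop) [Decidable p] (a b : ℂ),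
        (if p then a / b else 1) = (if p then a else 1) / (if p then b else 1) := by
      intro p _ a b; split <;> simp
    simp only [hz, leftRegion_inEdge_upRight, rightRegion_inEdge_upRight, leftRegion_inEdge_upLeft,
      rightRegion_inEdge_upLeft, leftRegion_outEdge_upRight, rightRegion_outEdge_upRight,
      leftRegion_outEdge_upLeft, rightRegion_outEdge_upLeft]
    simp only [Finset.prod_insert, Finset.mem_insert, Finset.mem_singleton, reduceCtorEq, or_self,
      not_false_eq_true, Finset.prod_singleton, hS, hE, hN, hW, ite_div]
    simp only [div_eq_mul_inv, mul_inv, inv_inv]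
    ring
  rw [Finset.prod_congr rfl fun c _ => hc c, Finset.prod_div_distrib]
  have h1 : ∏ c, ∏ s, z (D.outEdge c s) = ∏ e, z e := (Fintype.prod_prod_type z).symm
  have h2 : ∏ c, ∏ s, z (D.inEdge c s) = ∏ e, z e := by
    rw [← Equiv.prod_comp D.next.symm, Fintype.prod_prod_type]
    rfl
  rw [h1, h2, div_self (Finset.prod_ne_zero_iff.mpr fun e _ => hz0 e)]

end LinkDiagram

/-! ### Construction of a solution -/

theorem signed_smul_eigen {D : LinkDiagram} (c : D.Crossing) {g : SL(2, ℂ)} {l : ℂ}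
    {v : Fin 2 → ℂ} (hl : l ≠ 0) (h : g • v = l • v) : D.signed c g • v = D.signed c l • v := by
  unfold LinkDiagram.signed
  split_ifs
  · exact h
  · rw [inv_smul_eq_iff, smul_comm, h, smul_smul, inv_mul_cancel₀ hl, one_smul]

theorem bracket_signed_smul_ne_zero {D : LinkDiagram} (c : D.Crossing) {g : SL(2, ℂ)}
    {v : Fin 2 → ℂ} (h : bracket v (g • v) ≠ 0) : bracket v (D.signed c g • v) ≠ 0 := by
  unfold LinkDiagram.signed
  split_ifs
  · exact h
  · rw [bracket_ne_zero_comm, bracket_inv_smul_left]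
    exact h

namespace LinkDiagram

open GaussDiagram

variable (D : LinkDiagram)

/-- The data that determine a developing map in terms of vectors in `ℂ²`. -/
structure VectorData (φ : D.LinkGroup →* SL(2, ℂ)) where
  /-- the vector above the diagram -/
  p : Fin 2 → ℂ
  /-- the vectors below the diagram -/
  q : D.Region → Fin 2 → ℂ
  /-- eigenvectors of the meridians -/
  v : D.Edge → Fin 2 → ℂ
  /-- eigenvalues of the meridians -/
  l : D.Component → ℂ
  q_right : ∀ e, q (D.rightRegion e) = φ (D.meridian e) • q (D.leftRegion e)
  noncentral : ∀ e, ((φ (D.meridian e) : SL(2, ℂ)) : PSL(2, ℂ)) ≠ 1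
  v_ne : ∀ e, v e ≠ 0
  l_ne : ∀ i, l i ≠ 0
  eigen : ∀ e, φ (D.meridian e) • v e = l (D.component e) • v e
  generic_top : ∀ e, bracket p (φ (D.meridian e) • p) ≠ 0
  generic_bottom : ∀ e, bracket (q (D.leftRegion e)) (q (D.rightRegion e)) ≠ 0
  generic_edge : ∀ r, bracket p (q r) ≠ 0

namespace VectorData

variable {D} {φ : D.LinkGroup →* SL(2, ℂ)} (V : D.VectorData φ)

/-- The region variables. -/
def w (r : D.Region) : ℂ := bracket V.p (V.q r)

/-- The component variables. -/
noncomputable def m (i : D.Component) : ℂ := (V.l i)⁻¹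

theorem strandVar_eq (c : D.Crossing) (s : Strand) :
    D.strandVar V.m c s = (D.signed c (V.l (D.component (D.outEdge c s))))⁻¹ := D.signed_inv c _

/-- Eigenvectors are chosen edge by edge, but both edges of the over-strand have the same meridian
and eigenvalue, and a non-central meridian has a one-dimensional eigenspace. -/
theorem bracket_over (c : D.Crossing) :
    bracket (V.v (D.inEdge c .over)) (V.v (D.outEdge c .over)) = 0 := by
  refine CP1.bracket_eq_zero_of_eigen (V.noncentral (D.outEdge c .over)) ?_ (V.eigen _)
  have := V.eigen (D.inEdge c .over)
  rwa [meridian_over, component_inEdge] at this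

/-- By `meridian_under`, the inverse of the signed over-meridian conjugates the incoming
under-meridian into the outgoing one and so transports its eigenvectors. -/
theorem eigen_under (c : D.Crossing) :
    φ (D.meridian (D.outEdge c .under)) •
        ((D.signed c (φ (D.meridian (D.outEdge c .over))))⁻¹ • V.v (D.inEdge c .under)) =
      V.l (D.component (D.outEdge c .under)) •
        ((D.signed c (φ (D.meridian (D.outEdge c .over))))⁻¹ • V.v (D.inEdge c .under)) := by
  have h := congrArg φ (D.meridian_under c)
  rw [map_mul, map_mul, map_signed] at h
  have h' := V.eigen (D.inEdge c .under)
  rw [component_inEdge] at h'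
  rw [← smul_comm _ (V.l (D.component (D.outEdge c .under))), ← h', smul_smul, smul_smul,
    eq_inv_mul_iff_mul_eq.mpr h.symm]
  congr 1
  group

theorem bracket_under (c : D.Crossing) :
    bracket ((D.signed c (φ (D.meridian (D.outEdge c .over))))⁻¹ • V.v (D.inEdge c .under))
      (V.v (D.outEdge c .under)) = 0 :=
  CP1.bracket_eq_zero_of_eigen (V.noncentral (D.outEdge c .under)) (V.eigen_under c) (V.eigen _)

theorem crossingVectors (c : D.Crossing) : CrossingVectors V.p (V.v (D.outEdge c .over))
    (V.v (D.inEdge c .under)) (V.q (D.region c .south)) (V.q (D.region c (D.orient c .east)))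
    (V.q (D.region c .north)) (V.q (D.region c (D.orient c .west)))
    (D.signed c (φ (D.meridian (D.outEdge c .over))))
    (D.signed c (φ (D.meridian (D.inEdge c .under))))
    (D.signed c (V.l (D.component (D.outEdge c .over))))
    (D.signed c (V.l (D.component (D.outEdge c .under)))) where
  south := D.coloring_over_in V.q_right c
  east := D.coloring_over_out V.q_right c
  east' := D.coloring_under_in V.q_right c
  eigen_over := signed_smul_eigen c (V.l_ne _) (V.eigen _)
  eigen_under := signed_smul_eigen c (V.l_ne _) (by rw [V.eigen, component_inEdge])
  l_ne := by unfold signed; split <;> simp [V.l_ne]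
  κ_ne := by unfold signed; split <;> simp [V.l_ne]
  o_ne := V.v_ne _
  u_ne := V.v_ne _
  top := bracket_signed_smul_ne_zero c (V.generic_top _)
  top' := bracket_signed_smul_ne_zero c (V.generic_top _)
  -- Moving the over-meridian to the left factor gives an eigenvector of the outgoing
  -- under-meridian, to which `generic_top` applies.
  under_top := by
    rw [← bracket_inv_smul_left]
    exact bracket_eigen_ne_zero ((smul_ne_zero_iff_ne _).mpr (V.v_ne _)) (V.eigen_under c)
      (V.generic_top _)
  wS := V.generic_edge _
  wA := V.generic_edge _
  wN := V.generic_edge _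
  wB := V.generic_edge _
  BS := by
    have h := V.generic_bottom (D.inEdge c .over)
    unfold orient
    split_ifs with hc
    · obtain ⟨h1, h2, -⟩ := D.sides_of_positive hc
      rwa [h1, h2] at h
    · obtain ⟨h1, h2, -⟩ := D.sides_of_negative hc
      rw [h1, h2] at h
      exact bracket_ne_zero_comm.mp h
  NA := by
    have h := V.generic_bottom (D.outEdge c .over)
    unfold orient
    split_ifs with hc
    · obtain ⟨-, -, -, -, h1, h2, -⟩ := D.sides_of_positive hc
      rwa [h1, h2] at h
    · obtain ⟨-, -, -, -, h1, h2, -⟩ := D.sides_of_negative hc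
      rw [h1, h2] at h
      exact bracket_ne_zero_comm.mp h
  SA := by
    have h := V.generic_bottom (D.inEdge c .under)
    unfold orient
    split_ifs with hc
    · obtain ⟨-, -, h1, h2, -⟩ := D.sides_of_positive hc
      rwa [h1, h2] at h
    · obtain ⟨-, -, h1, h2, -⟩ := D.sides_of_negative hc
      rw [h1, h2] at h
      exact bracket_ne_zero_comm.mp h

theorem p_ne : V.p ≠ 0 := ne_zero_of_bracket_left (V.generic_edge (Classical.arbitrary _))

theorem q_ne (r : D.Region) : V.q r ≠ 0 := ne_zero_of_bracket_right (V.generic_edge r)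

/-- The developing map. -/
noncomputable def developingMap {ρ : D.LinkGroup →* PSL(2, ℂ)}
    (hρ : ∀ x, ((φ x : SL(2, ℂ)) : PSL(2, ℂ)) = ρ x) : D.DevelopingMap ρ where
  top := Projectivization.mk ℂ V.p V.p_ne
  bottom r := Projectivization.mk ℂ (V.q r) (V.q_ne r)
  cusp e := Projectivization.mk ℂ (V.v e) (V.v_ne e)
  bottom_eq e := by
    simp only [← hρ, CP1.coe_smul_mk, V.q_right]
  cusp_fixed e := by
    rw [← hρ, CP1.coe_smul_mk, CP1.mk_eq_mk, V.eigen, bracket_smul_left, bracket_self, mul_zero]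
  cusp_over c := by
    rw [CP1.mk_eq_mk]
    exact V.bracket_over c
  cusp_under c := by
    change _ = D.signed c (ρ (D.meridian (D.outEdge c .over))) • _
    rw [eq_comm, ← eq_inv_smul_iff, ← map_signed, ← hρ, map_signed, ← QuotientGroup.mk_inv,
      CP1.coe_smul_mk, CP1.mk_eq_mk, bracket_swap, V.bracket_under, neg_zero]

theorem hasShape {ρ : D.LinkGroup →* PSL(2, ℂ)}
    (hρ : ∀ x, ((φ x : SL(2, ℂ)) : PSL(2, ℂ)) = ρ x) : (V.developingMap hρ).HasShape V.w V.m := by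
  rw [DevelopingMap.hasShape_iff]
  intro c
  have := (V.crossingVectors c).isOctahedron
  simp only [strandVar_eq]
  rw [← map_signed, ← hρ, map_signed]
  simp only [cornerVar, orient_south, orient_north]
  exact this

/-- The factors at the half-edges into which the critical equations split. -/
noncomputable def edgeFactor (e : D.Edge) (r : D.Region) : ℂ :=
  bracket (V.v e) (V.q r) / bracket (V.v e) V.p

theorem edgeFactor_over (c : D.Crossing) (r : D.Region) :
    V.edgeFactor (D.inEdge c .over) r =
      bracket (V.v (D.outEdge c .over)) (V.q r) / bracket (V.v (D.outEdge c .over)) V.p :=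
  bracket_div_bracket_congr (V.v_ne _) (V.v_ne _) (V.bracket_over c) _ _

theorem edgeFactor_under (c : D.Crossing) (r : D.Region) :
    V.edgeFactor (D.outEdge c .under) r =
      bracket ((D.signed c (φ (D.meridian (D.outEdge c .over))))⁻¹ • V.v (D.inEdge c .under))
        (V.q r) /
      bracket ((D.signed c (φ (D.meridian (D.outEdge c .over))))⁻¹ • V.v (D.inEdge c .under)) V.p :=
  (bracket_div_bracket_congr ((smul_ne_zero_iff_ne _).mpr (V.v_ne _)) (V.v_ne _)
    (V.bracket_under c) _ _).symm

theorem bracket_left_ne (e : D.Edge) : bracket (V.v e) (V.q (D.leftRegion e)) ≠ 0 :=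
  bracket_eigen_ne_zero (V.v_ne e) (V.eigen e) (by rw [← V.q_right]; exact V.generic_bottom e)

theorem bracket_right_ne (e : D.Edge) : bracket (V.v e) (V.q (D.rightRegion e)) ≠ 0 := by
  rw [V.q_right, bracket_eigen_smul (V.l_ne _) (V.eigen e)]
  exact mul_ne_zero (inv_ne_zero (V.l_ne _)) (V.bracket_left_ne e)

theorem bracket_top_ne (e : D.Edge) : bracket (V.v e) V.p ≠ 0 :=
  bracket_eigen_ne_zero (V.v_ne e) (V.eigen e) (V.generic_top e)

/-- Edge factors do not change when the eigenvector is rescaled, so the vectors in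
`positiveFactor_eq` may be replaced by the chosen eigenvectors of the four half-edges. -/
theorem cornerFactor_eq (c : D.Crossing) (k : Corner) :
    D.cornerFactor V.w V.m c (D.orient c k) = D.signed c (match k with
      | .south => V.edgeFactor (D.inEdge c .over) (D.region c .south) /
          V.edgeFactor (D.inEdge c .under) (D.region c .south)
      | .east => V.edgeFactor (D.inEdge c .under) (D.region c (D.orient c .east)) /
          V.edgeFactor (D.outEdge c .over) (D.region c (D.orient c .east))
      | .north => V.edgeFactor (D.outEdge c .over) (D.region c .north) /
          V.edgeFactor (D.outEdge c .under) (D.region c .north)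
      | .west => V.edgeFactor (D.outEdge c .under) (D.region c (D.orient c .west)) /
          V.edgeFactor (D.inEdge c .over) (D.region c (D.orient c .west))) := by
  have h := (V.crossingVectors c).positiveFactor_eq k
  unfold cornerFactor
  rw [D.orient_involutive c k]
  congr 1
  simp only [strandVar_eq, edgeFactor_over, edgeFactor_under]
  simp only [cornerVar, orient_south, orient_north]
  exact h

/-- Each corner factor is a quotient of edge factors at its two half-edges, as `prod_corner_eq_one`
requires. At a negative crossing the inversion, the reflection and the exchange of the up-right and
up-left strands combine to the same pattern. -/
theorem isSolution (harg : ∀ c, NonrealArguments (D.cornerVar V.w c .south)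
      (D.cornerVar V.w c .east) (D.cornerVar V.w c .north) (D.cornerVar V.w c .west)
      (D.strandVar V.m c .under) (D.strandVar V.m c .over)) : D.IsSolution V.w V.m := by
  refine D.isSolution_of_prod_cornerFactor V.w V.m V.generic_edge harg ?_
  have hk := V.cornerFactor_eq
  refine D.prod_corner_eq_one _ (fun e => V.edgeFactor e (D.leftRegion e))
    (fun e => V.edgeFactor e (D.rightRegion e))
    (fun e => div_ne_zero (V.bracket_left_ne e) (V.bracket_top_ne e))
    (fun e => div_ne_zero (V.bracket_right_ne e) (V.bracket_top_ne e)) ?_ ?_ ?_ ?_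
  · intro c
    have := hk c .south
    rw [rightRegion_inEdge_upRight, leftRegion_inEdge_upLeft]
    unfold upRight upLeft
    unfold signed orient at this
    split_ifs at this ⊢
    · exact this
    · rw [inv_div] at this; exact this
  · intro c
    rw [rightRegion_inEdge_upLeft, rightRegion_outEdge_upRight]
    have h1 := hk c .east
    have h2 := hk c .west
    unfold upRight upLeft
    unfold signed orient at h1 h2
    split_ifs at h1 h2 ⊢
    · exact h1
    · rw [inv_div] at h2; exact h2
  · intro c
    have := hk c .north
    rw [leftRegion_outEdge_upRight, rightRegion_outEdge_upLeft]
    unfold upRight upLeft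
    unfold signed orient at this
    split_ifs at this ⊢
    · exact this
    · rw [inv_div] at this; exact this
  · intro c
    rw [leftRegion_outEdge_upLeft, leftRegion_inEdge_upRight]
    have h1 := hk c .east
    have h2 := hk c .west
    unfold upRight upLeft
    unfold signed orient at h1 h2
    split_ifs at h1 h2 ⊢
    · exact h2
    · rw [inv_div] at h1; exact h1

end VectorData

end LinkDiagram

/-! ### Existence of generic developing vectors. -/

namespace LinkDiagram

open GaussDiagram

variable (D : LinkDiagram)

/-- Meridians along a component are conjugate. Equal traces allow a single eigenvalue for the whole
component. -/
theorem trace_meridian (φ : D.LinkGroup →* SL(2, ℂ)) {e e' : D.Edge}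
    (h : D.component e = D.component e') :
    (φ (D.meridian e)).1.trace = (φ (D.meridian e')).1.trace := by
  refine (D.component_induction
    (P := fun x => (φ (D.meridian x)).1.trace = (φ (D.meridian e)).1.trace) ?_ h rfl).symm
  intro c s hs
  rw [← hs]
  cases s
  · rw [meridian_over]
  · have hm := congrArg φ (D.meridian_under c)
    rw [map_mul, map_mul] at hm
    set x := φ (D.signed c (D.meridian (D.outEdge c .over)))
    rw [eq_inv_mul_iff_mul_eq.mpr hm.symm, Matrix.SpecialLinearGroup.coe_mul,
      Matrix.trace_mul_comm, ← Matrix.SpecialLinearGroup.coe_mul, mul_inv_cancel_right]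

theorem exists_eigenvectors (φ : D.LinkGroup →* SL(2, ℂ)) :
    ∃ (l : D.Component → ℂ) (v : D.Edge → Fin 2 → ℂ), (∀ i, l i ≠ 0) ∧ (∀ e, v e ≠ 0) ∧
      ∀ e, φ (D.meridian e) • v e = l (D.component e) • v e := by
  choose l hl using fun i : D.Component => CP1.exists_charpoly_root
    (φ (D.meridian (Quotient.out i))).1.trace
  have hl' : ∀ e, l (D.component e) ^ 2 - (φ (D.meridian e)).1.trace * l (D.component e) + 1 = 0 := by
    intro e
    rw [D.trace_meridian φ (e' := Quotient.out (D.component e)) (Quotient.out_eq _).symm]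
    exact hl _
  choose v hv hlv using fun e => CP1.exists_eigenvector (φ (D.meridian e)) (hl' e)
  refine ⟨l, v, fun i h0 => ?_, hv, hlv⟩
  have := hl i
  simp [h0] at this

/-- A region coloring in `SL(2, ℂ)` acts on one base vector. The condition at each edge excludes the
zeros of a polynomial in this vector, and that polynomial is non-zero because the meridian is not
central. -/
theorem exists_bottom (φ : D.LinkGroup →* SL(2, ℂ))
    (hφ : ∀ e, ((φ (D.meridian e) : SL(2, ℂ)) : PSL(2, ℂ)) ≠ 1) :
    ∃ q : D.Region → Fin 2 → ℂ,
      (∀ e, q (D.rightRegion e) = φ (D.meridian e) • q (D.leftRegion e)) ∧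
      ∀ e, bracket (q (D.leftRegion e)) (q (D.rightRegion e)) ≠ 0 := by
  obtain ⟨F, hF⟩ := D.exists_region_coloring (fun e => φ (D.meridian e)) (D.isFlat_meridian φ)
  obtain ⟨b, hb, -⟩ := exists_generic (κ := Empty) (E := Fin 2 → ℂ)
    (fun (e : D.Edge) x => bracket (F (D.leftRegion e) • x) (F (D.rightRegion e) • x))
    (fun e => analyticOnNhd_bracket (analyticOnNhd_smul_coord _) (analyticOnNhd_smul_coord _))
    (fun e => by
      obtain ⟨v, hv⟩ := CP1.exists_bracket_smul_ne_zero (hφ e)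
      refine ⟨(F (D.leftRegion e))⁻¹ • v, ?_⟩
      rwa [hF, mul_smul, smul_inv_smul])
    Empty.elim Empty.elim (fun k => k.elim) (fun k => k.elim) (fun k => k.elim) (fun k => k.elim)
  exact ⟨fun r => F r • b, fun e => by simp only [hF, mul_smul], hb⟩

/-- The numerators and denominators of the five arguments of the dilogarithm, without component
variables. -/
def argumentVectors (S A N B p : Fin 2 → ℂ) : Fin 5 → ℂ × ℂ
  | 0 => (bracket p B, bracket p S)
  | 1 => (bracket p A, bracket p S)
  | 2 => (bracket p N, bracket p A)
  | 3 => (bracket p N, bracket p B)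
  | 4 => (bracket p S * bracket p N, bracket p B * bracket p A)

theorem analyticOnNhd_argumentVectors (S A N B : Fin 2 → ℂ) (i : Fin 5) :
    AnalyticOnNhd ℂ (fun p => (argumentVectors S A N B p i).1) Set.univ ∧
      AnalyticOnNhd ℂ (fun p => (argumentVectors S A N B p i).2) Set.univ := by
  have h : ∀ x : Fin 2 → ℂ, AnalyticOnNhd ℂ (fun p => bracket p x) Set.univ := fun x =>
    analyticOnNhd_bracket analyticOnNhd_coord fun _ => analyticOnNhd_const
  fin_cases i
  · exact ⟨h B, h S⟩
  · exact ⟨h A, h S⟩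
  · exact ⟨h N, h A⟩
  · exact ⟨h N, h B⟩
  · exact ⟨(h S).mul (h N), (h B).mul (h A)⟩

/-- A zero of the denominator at which the numerator survives rules out proportionality. It is found
by setting `p` equal to a vector whose bracket with `p` divides the denominator. -/
theorem argumentVectors_nonconstant {S A N B : Fin 2 → ℂ} (hSA : bracket S A ≠ 0)
    (hSB : bracket S B ≠ 0) (hNA : bracket N A ≠ 0) (hNB : bracket N B ≠ 0) (i : Fin 5) :
    (∃ p, (argumentVectors S A N B p i).2 ≠ 0) ∧
      ∃ p, (argumentVectors S A N B p i).1 ≠ 0 ∧ (argumentVectors S A N B p i).2 = 0 := by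
  have hAS := bracket_ne_zero_comm.mp hSA
  have hBS := bracket_ne_zero_comm.mp hSB
  have hAN := bracket_ne_zero_comm.mp hNA
  have hBN := bracket_ne_zero_comm.mp hNB
  fin_cases i
  · exact ⟨⟨B, hBS⟩, S, hSB, bracket_self S⟩
  · exact ⟨⟨A, hAS⟩, S, hSA, bracket_self S⟩
  · exact ⟨⟨N, hNA⟩, A, hAN, bracket_self A⟩
  · exact ⟨⟨N, hNB⟩, B, hBN, bracket_self B⟩
  · exact ⟨⟨N, mul_ne_zero hNB hNA⟩, A, mul_ne_zero hAS hAN, by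
      simp [argumentVectors, bracket_self]⟩

/-- Generic developing data exist. -/
theorem exists_vectorData (φ : D.LinkGroup →* SL(2, ℂ))
    (hφ : ∀ e, ((φ (D.meridian e) : SL(2, ℂ)) : PSL(2, ℂ)) ≠ 1) :
    ∃ V : D.VectorData φ, ∀ c, NonrealArguments (D.cornerVar V.w c .south)
      (D.cornerVar V.w c .east) (D.cornerVar V.w c .north) (D.cornerVar V.w c .west)
      (D.strandVar V.m c .under) (D.strandVar V.m c .over) := by
  obtain ⟨l, v, hl, hv, hlv⟩ := D.exists_eigenvectors φ
  obtain ⟨q, hq, hqgen⟩ := D.exists_bottom φ hφ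
  have hq0 : ∀ r, q r ≠ 0 := by
    intro r
    refine D.region_induction (P := fun r => q r ≠ 0) (fun e => ?_)
      (D.leftRegion (Classical.choice D.nonempty_crossing, .over)) r
      (ne_zero_of_bracket_left (hqgen _))
    rw [hq, smul_ne_zero_iff_ne]
  have hcorner : ∀ c, bracket (q (D.region c .south)) (q (D.region c .east)) ≠ 0 ∧
      bracket (q (D.region c .south)) (q (D.region c .west)) ≠ 0 ∧
      bracket (q (D.region c .north)) (q (D.region c .east)) ≠ 0 ∧
      bracket (q (D.region c .north)) (q (D.region c .west)) ≠ 0 := by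
    intro c
    have h1 := hqgen (D.inEdge c (D.upRight c))
    have h2 := hqgen (D.inEdge c (D.upLeft c))
    have h3 := hqgen (D.outEdge c (D.upRight c))
    have h4 := hqgen (D.outEdge c (D.upLeft c))
    rw [rightRegion_inEdge_upRight, leftRegion_inEdge_upRight] at h1
    rw [rightRegion_inEdge_upLeft, leftRegion_inEdge_upLeft] at h2
    rw [rightRegion_outEdge_upRight, leftRegion_outEdge_upRight] at h3
    rw [rightRegion_outEdge_upLeft, leftRegion_outEdge_upLeft] at h4
    exact ⟨h2, bracket_ne_zero_comm.mp h1, h3, bracket_ne_zero_comm.mp h4⟩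
  have hcorner' : ∀ c, bracket (q (D.region c .south)) (q (D.region c (D.orient c .east))) ≠ 0 ∧
      bracket (q (D.region c .south)) (q (D.region c (D.orient c .west))) ≠ 0 ∧
      bracket (q (D.region c .north)) (q (D.region c (D.orient c .east))) ≠ 0 ∧
      bracket (q (D.region c .north)) (q (D.region c (D.orient c .west))) ≠ 0 := by
    intro c
    obtain ⟨h1, h2, h3, h4⟩ := hcorner c
    unfold orient
    split_ifs
    · exact ⟨h1, h2, h3, h4⟩
    · exact ⟨h2, h1, h4, h3⟩
  let y : D.Crossing × Fin 5 → (Fin 2 → ℂ) → ℂ × ℂ := fun k p =>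
    argumentVectors (q (D.region k.1 .south)) (q (D.region k.1 (D.orient k.1 .east)))
      (q (D.region k.1 .north)) (q (D.region k.1 (D.orient k.1 .west))) p k.2
  let x : D.Crossing → ℂ × ℂ := fun c => (D.signed c (l (D.component (D.outEdge c .over))),
    D.signed c (l (D.component (D.outEdge c .under))))
  have hx : ∀ c, (x c).1 ≠ 0 ∧ (x c).2 ≠ 0 := by
    intro c
    simp only [x, signed]
    split_ifs <;> simp [hl]
  -- As `m = 1 / l`, the eigenvalues appear as constant factors in the numerators; the middle
  -- argument contains no component variable.
  let f : D.Crossing × Fin 5 → ℂ := fun k => ![(x k.1).1, (x k.1).2, (x k.1).1, (x k.1).2, 1] k.2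
  have hf : ∀ k, f k ≠ 0 := by
    rintro ⟨c, i⟩
    fin_cases i <;> simp [f, hx]
  obtain ⟨p, hp, harg⟩ := exists_generic (E := Fin 2 → ℂ) (ι := D.Edge ⊕ D.Region)
    (κ := D.Crossing × Fin 5)
    (Sum.elim (fun e p => bracket p (φ (D.meridian e) • p)) (fun r p => bracket p (q r)))
    (by
      rintro (e | r)
      · exact analyticOnNhd_bracket analyticOnNhd_coord (analyticOnNhd_smul_coord _)
      · exact analyticOnNhd_bracket analyticOnNhd_coord fun _ => analyticOnNhd_const)
    (by
      rintro (e | r)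
      · exact CP1.exists_bracket_smul_ne_zero (hφ e)
      · exact exists_bracket_ne_zero (hq0 r))
    (fun k p => f k * (y k p).1) (fun k p => (y k p).2)
    (fun k => analyticOnNhd_const.mul (analyticOnNhd_argumentVectors _ _ _ _ k.2).1)
    (fun k => (analyticOnNhd_argumentVectors _ _ _ _ k.2).2)
    (fun k => by
      obtain ⟨h1, h2, h3, h4⟩ := hcorner' k.1
      exact (argumentVectors_nonconstant h1 h2 h3 h4 k.2).1)
    (fun k c => by
      obtain ⟨h1, h2, h3, h4⟩ := hcorner' k.1
      obtain ⟨p, h, h'⟩ := (argumentVectors_nonconstant h1 h2 h3 h4 k.2).2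
      refine ⟨p, ?_⟩
      simp only [y]
      rw [h', mul_zero]
      exact mul_ne_zero (hf k) h)
  refine ⟨{ p := p, q := q, v := v, l := l, q_right := hq, noncentral := hφ, v_ne := hv,
            l_ne := hl, eigen := hlv, generic_top := fun e => hp (Sum.inl e),
            generic_bottom := hqgen, generic_edge := fun r => hp (Sum.inr r) }, fun c => ?_⟩
  simp only [VectorData.strandVar_eq, cornerVar, orient_south, orient_north, VectorData.w]
  have hinv : ∀ a b d : ℂ, a / (d⁻¹ * b) = d * a / b := by
    intro a b d
    simp only [div_eq_mul_inv, mul_inv, inv_inv]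
    ring
  refine ⟨?_, ?_, ?_, ?_, ?_⟩
  · rw [hinv]; exact harg (c, 0)
  · rw [hinv]; exact harg (c, 1)
  · rw [hinv]; exact harg (c, 2)
  · rw [hinv]; exact harg (c, 3)
  · have := harg (c, 4)
    rw [show f (c, 4) = 1 from rfl] at this
    simp only [one_mul] at this
    exact this

/-- Arguments of the dilogarithm that are not real are not equal to `1`. -/
theorem isNondegenerate_of_nonrealArguments (w : D.Region → ℂ) (m : D.Component → ℂ)
    (h : ∀ c, NonrealArguments (D.cornerVar w c .south) (D.cornerVar w c .east)
      (D.cornerVar w c .north) (D.cornerVar w c .west) (D.strandVar m c .under)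
      (D.strandVar m c .over)) : D.IsNondegenerate w m := by
  intro c
  have hne : ∀ {x : ℂ}, x.im ≠ 0 → x ≠ 1 := by rintro x hx rfl; simp at hx
  have hx : ∀ x y z : ℂ, x * y / z = y / (x⁻¹ * z) := by
    intro x y z
    simp only [div_eq_mul_inv, mul_inv, inv_inv]
    ring
  obtain ⟨h1, h2, h3, h4, h5⟩ := h c
  replace h1 := hne h1
  replace h2 := hne h2
  replace h3 := hne h3
  replace h4 := hne h4
  replace h5 := hne h5
  simp only [cornerVar, strandVar, signed, orient, mα, mβ, GaussDiagram.upLeft,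
    GaussDiagram.upRight] at h1 h2 h3 h4 h5 ⊢
  split_ifs at h1 h2 h3 h4 h5 ⊢
  · exact ⟨h1, h2, h3, h4, h5⟩
  · simp only [Corner.reflect] at h1 h2 h3 h4 h5
    refine ⟨?_, ?_, ?_, ?_, h5⟩
    · rw [hx]; exact h2
    · rw [hx]; exact h1
    · rw [hx]; exact h4
    · rw [hx]; exact h3

end LinkDiagram

/-! ### Rigidity of the developing map -/

namespace CP1

/-- `PSL(2, ℂ)` acts freely on triples of distinct points. -/
theorem eq_of_smul_eq {g h : PSL(2, ℂ)} {x y z : CP1} (hxy : x ≠ y) (hxz : x ≠ z) (hyz : y ≠ z)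
    (hx : g • x = h • x) (hy : g • y = h • y) (hz : g • z = h • z) : g = h := by
  rw [← inv_mul_eq_one]
  replace hx : (g⁻¹ * h) • x = x := by rw [mul_smul, ← hx, inv_smul_smul]
  replace hy : (g⁻¹ * h) • y = y := by rw [mul_smul, ← hy, inv_smul_smul]
  replace hz : (g⁻¹ * h) • z = z := by rw [mul_smul, ← hz, inv_smul_smul]
  generalize g⁻¹ * h = k at *
  induction k using QuotientGroup.induction_on with
  | H k =>
  induction x using Projectivization.ind with | _ a ha =>
  induction y using Projectivization.ind with | _ b hb =>
  induction z using Projectivization.ind with | _ c hc =>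
  rw [ne_eq, mk_eq_mk] at hxy hxz hyz
  rw [coe_smul_mk, eq_comm, mk_eq_mk, bracket_eq_zero_iff ‹_›] at hx hy hz
  obtain ⟨α, hα⟩ := hx
  obtain ⟨β, hβ⟩ := hy
  obtain ⟨γ, hγ⟩ := hz
  have h1 := bracket_smul_smul k a b
  have h2 := bracket_smul_smul k a c
  -- Invariance of brackets gives `α β = 1 = α γ`. Two different eigenlines then share an
  -- eigenvalue, which forces the matrix to be central.
  rw [hα, hβ, bracket_smul_left, bracket_smul_right, ← mul_assoc, mul_eq_right₀ hxy] at h1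
  rw [hα, hγ, bracket_smul_left, bracket_smul_right, ← mul_assoc, mul_eq_right₀ hxz] at h2
  have hβγ : β = γ := mul_left_cancel₀ (left_ne_zero_of_mul_eq_one h1) (h1.trans h2.symm)
  subst hβγ
  by_contra hk
  exact hyz (bracket_eq_zero_of_eigen hk hβ hγ)

/-- `PSL(2, ℂ)` acts transitively on triples of distinct points. -/
theorem exists_smul_eq {x y z x' y' z' : CP1} (hxy : x ≠ y) (hxz : x ≠ z) (hyz : y ≠ z)
    (hxy' : x' ≠ y') (hxz' : x' ≠ z') (hyz' : y' ≠ z') :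
    ∃ g : PSL(2, ℂ), g • x = x' ∧ g • y = y' ∧ g • z = z' := by
  induction x using Projectivization.ind with | _ a ha =>
  induction y using Projectivization.ind with | _ b hb =>
  induction z using Projectivization.ind with | _ c hc =>
  induction x' using Projectivization.ind with | _ a' ha' =>
  induction y' using Projectivization.ind with | _ b' hb' =>
  induction z' using Projectivization.ind with | _ c' hc' =>
  rw [ne_eq, mk_eq_mk] at hxy hxz hyz hxy' hxz' hyz'
  -- The matrix sends `a` to `μ • a'` and `b` to `ν • b'`. The ratio of `μ` and `ν` is fixed by
  -- sending `c` to the line of `c'`, and the square root `t` normalizes the determinant to `1`.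
  obtain ⟨t, ht⟩ := IsAlgClosed.exists_eq_mul_self
    (bracket a b * (bracket b c * bracket a c) / (bracket a' b' * (bracket b' c' * bracket a' c')))
  set μ := t * (bracket b' c' / bracket b c) with hμ
  set ν := t * (bracket a' c' / bracket a c) with hν
  let M : Matrix (Fin 2) (Fin 2) ℂ := (bracket a b)⁻¹ •
    !![μ * a' 0 * b 1 - ν * b' 0 * a 1, ν * b' 0 * a 0 - μ * a' 0 * b 0;
      μ * a' 1 * b 1 - ν * b' 1 * a 1, ν * b' 1 * a 0 - μ * a' 1 * b 0]
  have hprod : μ * ν * bracket a' b' = bracket a b := by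
    have : μ * ν * bracket a' b' = t * t * (bracket b' c' / bracket b c) *
      (bracket a' c' / bracket a c) * bracket a' b' := by rw [hμ, hν]; ring
    rw [this, ← ht]
    field_simp
  have hdet : M.det = 1 := by
    have : M.det = (bracket a b)⁻¹ ^ 2 * (μ * ν * bracket a' b' * bracket a b) := by
      simp only [M, Matrix.det_fin_two, Matrix.smul_apply, Matrix.of_apply, Matrix.cons_val',
        Matrix.cons_val_zero, Matrix.cons_val_one, Matrix.cons_val_fin_one, smul_eq_mul, bracket]
      ring
    rw [this, hprod]
    field_simp
  have hM : ∀ v : Fin 2 → ℂ, M.mulVec v =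
      (bracket a b)⁻¹ • ((μ * bracket v b) • a' + (ν * bracket a v) • b') := by
    intro v
    ext i
    fin_cases i <;>
    · simp [M, Matrix.mulVec, dotProduct, Fin.sum_univ_two, bracket]
      ring
  let g : SL(2, ℂ) := ⟨M, hdet⟩
  refine ⟨g, ?_, ?_, ?_⟩
  · rw [coe_smul_mk, mk_eq_mk, show g • a = M.mulVec a from rfl, hM, bracket_self, bracket_smul_left,
      mul_zero, zero_smul, add_zero, bracket_smul_left, bracket_self, mul_zero, mul_zero]
  · rw [coe_smul_mk, mk_eq_mk, show g • b = M.mulVec b from rfl, hM, bracket_self, bracket_smul_left,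
      mul_zero, zero_smul, zero_add, bracket_smul_left, bracket_self, mul_zero, mul_zero]
  · rw [coe_smul_mk, mk_eq_mk, show g • c = M.mulVec c from rfl, hM, bracket_smul_left]
    have hadd : ∀ u v w : Fin 2 → ℂ, bracket (u + v) w = bracket u w + bracket v w := by
      intro u v w; simp only [bracket, Pi.add_apply]; ring
    rw [hadd, bracket_smul_left, bracket_smul_left, hμ, hν, bracket_swap c b]
    field_simp
    ring

/-- The fourth vertex of an ideal tetrahedron is determined by the cross-ratio. -/
theorem eq_of_crossRatio_eq {x y z s t : CP1} (hxy : x ≠ y) (hxz : x ≠ z) (hyz : y ≠ z)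
    (hys : y ≠ s) (hyt : y ≠ t) (h : crossRatio x y z s = crossRatio x y z t) : s = t := by
  rw [ne_eq, eq_iff_bracket_rep] at *
  unfold crossRatio at h
  rw [div_eq_div_iff (mul_ne_zero hxz hys) (mul_ne_zero hxz hyt)] at h
  -- Equality of the cross-ratios cancels two of the three Plücker terms, leaving the product of the
  -- brackets of `x, y` and of `s, t`.
  have hP := bracket_pluecker x.rep y.rep s.rep t.rep
  have h' : bracket x.rep s.rep * bracket y.rep t.rep = bracket x.rep t.rep * bracket y.rep s.rep :=
    mul_left_cancel₀ (mul_ne_zero hyz hxz) (by linear_combination h)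
  rw [h', sub_add_cancel] at hP
  exact (mul_eq_zero.mp hP).resolve_left hxy

end CP1

/-! ### Rigidity of tetrahedra and octahedra. -/

namespace IsIdealTetrahedron

variable {z : ℂ} {a b c d a' b' c' d' : CP1}

theorem swap_edge (h : IsIdealTetrahedron z a b c d) : IsIdealTetrahedron z b a d c := by
  obtain ⟨h1, h2, h3, h4, h5, h6, h7⟩ := h
  refine ⟨h1.symm, h5, h4, h3, h2, h6.symm, ?_⟩
  rw [← h7]
  unfold crossRatio
  rw [mul_comm, mul_comm (bracket b.rep d.rep)]

theorem swap_opposite (h : IsIdealTetrahedron z a b c d) : IsIdealTetrahedron z c d a b := by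
  obtain ⟨h1, h2, h3, h4, h5, h6, h7⟩ := h
  refine ⟨h6, h2.symm, h4.symm, h3.symm, h5.symm, h1, ?_⟩
  rw [← h7]
  unfold crossRatio
  rw [bracket_swap c.rep b.rep, bracket_swap d.rep a.rep, bracket_swap c.rep a.rep,
    bracket_swap d.rep b.rep, neg_mul_neg, neg_mul_neg, mul_comm (bracket b.rep c.rep)]

/-- Möbius transformations preserve the cross-ratio, which together with three vertices determines
the fourth. The symmetries above extend this to the other vertices. -/
theorem carry_fourth (h : IsIdealTetrahedron z a b c d) (h' : IsIdealTetrahedron z a' b' c' d')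
    {g : PSL(2, ℂ)} (ha : g • a = a') (hb : g • b = b') (hc : g • c = c') : g • d = d' := by
  subst ha hb hc
  obtain ⟨h1, h2, h3, h4, h5, h6, h7⟩ := h
  obtain ⟨h1', h2', h3', h4', h5', h6', h7'⟩ := h'
  refine CP1.eq_of_crossRatio_eq h1' h2' h4' ?_ h5' ?_
  · exact fun h => h5 (smul_left_cancel g h)
  · rw [CP1.crossRatio_smul, h7, h7']

theorem carry (h : IsIdealTetrahedron z a b c d) (h' : IsIdealTetrahedron z a' b' c' d')
    (g : PSL(2, ℂ)) :
    (g • a = a' → g • b = b' → g • c = c' → g • d = d') ∧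
    (g • a = a' → g • b = b' → g • d = d' → g • c = c') ∧
    (g • a = a' → g • c = c' → g • d = d' → g • b = b') ∧
    (g • b = b' → g • c = c' → g • d = d' → g • a = a') :=
  ⟨h.carry_fourth h', fun ha hb hd => h.swap_edge.carry_fourth h'.swap_edge hb ha hd,
    fun ha hc hd => h.swap_opposite.carry_fourth h'.swap_opposite hc hd ha,
    fun hb hc hd => h.swap_opposite.swap_edge.carry_fourth h'.swap_opposite.swap_edge hd hc hb⟩

end IsIdealTetrahedron

/-- A Möbius transformation that carries a face of a developed octahedron to the corresponding
face of another one with the same shape carries all vertices to each other. -/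
theorem IsOctahedron.carry {z₁ z₂ z₃ z₄ z₅ : ℂ} {o u p s q t o' u' p' s' q' t' : CP1}
    (h : IsOctahedron z₁ z₂ z₃ z₄ z₅ o u p s q t)
    (h' : IsOctahedron z₁ z₂ z₃ z₄ z₅ o' u' p' s' q' t') {g : PSL(2, ℂ)}
    (hou : g • o = o' ∨ g • u = u') (hps : g • p = p' ∨ g • s = s')
    (hqt : g • q = q' ∨ g • t = t') :
    g • o = o' ∧ g • u = u' ∧ g • p = p' ∧ g • s = s' ∧ g • q = q' ∧ g • t = t' := by
  obtain ⟨h1, h2, h3, h4, h5⟩ := h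
  obtain ⟨h1', h2', h3', h4', h5'⟩ := h'
  obtain ⟨a1, a2, a3, a4⟩ := h1.carry h1' g
  obtain ⟨b1, b2, b3, b4⟩ := h2.carry h2' g
  obtain ⟨c1, c2, c3, c4⟩ := h3.carry h3' g
  obtain ⟨d1, d2, d3, d4⟩ := h4.carry h4' g
  obtain ⟨e1, e2, e3, e4⟩ := h5.carry h5' g
  clear h1 h2 h3 h4 h5 h1' h2' h3' h4' h5'
  -- Each of the eight choices is a face of one of the four outer tetrahedra. That tetrahedron
  -- shares a face with the middle one, from which the remaining vertices are reached.
  rcases hou with i | i <;> rcases hps with j | j <;> rcases hqt with k | k <;> simp_all only [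
    true_implies, and_self]

/-! ### Propagation over the diagram, and conjugacy of the representations. -/

namespace LinkDiagram

open GaussDiagram

variable {D : LinkDiagram}

namespace DevelopingMap

section Basic

variable {ρ : D.LinkGroup →* PSL(2, ℂ)} (d : D.DevelopingMap ρ)

theorem signed_smul_cusp (c : D.Crossing) :
    D.signed c (ρ (D.meridian (D.outEdge c .over))) • d.cusp (D.outEdge c .over) =
      d.cusp (D.outEdge c .over) := by
  unfold signed
  split_ifs
  · exact d.cusp_fixed _
  · rw [inv_smul_eq_iff, d.cusp_fixed]

theorem signed_smul_cusp_under (c : D.Crossing) :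
    D.signed c (ρ (D.meridian (D.outEdge c .over))) • d.cusp (D.outEdge c .under) =
      d.cusp (D.inEdge c .under) :=
  (d.cusp_under c).symm

end Basic

variable {ρ ρ' : D.LinkGroup →* PSL(2, ℂ)} (d : D.DevelopingMap ρ) (d' : D.DevelopingMap ρ')

/-- `g` carries the face of an octahedron at the edge `e`, the viewer and the region `r` from one
developing map to another. -/
def Carries (g : PSL(2, ℂ)) (e : D.Edge) (r : D.Region) : Prop :=
  g • d.cusp e = d'.cusp e ∧ g • d.top = d'.top ∧ g • d.bottom r = d'.bottom r

variable {d d'} {w : D.Region → ℂ} {m : D.Component → ℂ}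

/-- The faces in front of the over-strand, on the side of the incoming under-strand. -/
theorem carries_near (h : d.HasShape w m) (h' : d'.HasShape w m) {g : PSL(2, ℂ)} {c : D.Crossing}
    (hg : Carries d d' g (D.outEdge c .over) (D.region c .south) ∨
      Carries d d' g (D.outEdge c .over) (D.region c (D.orient c .east)) ∨
      Carries d d' g (D.inEdge c .under) (D.region c .south) ∨
      Carries d d' g (D.inEdge c .under) (D.region c (D.orient c .east))) :
    g • d.cusp (D.outEdge c .over) = d'.cusp (D.outEdge c .over) ∧
    g • d.cusp (D.inEdge c .under) = d'.cusp (D.inEdge c .under) ∧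
    g • d.top = d'.top ∧
    g • (D.signed c (ρ (D.meridian (D.outEdge c .over))) • d.top) =
      D.signed c (ρ' (D.meridian (D.outEdge c .over))) • d'.top ∧
    g • d.bottom (D.region c .south) = d'.bottom (D.region c .south) ∧
    g • d.bottom (D.region c (D.orient c .east)) = d'.bottom (D.region c (D.orient c .east)) := by
  rw [hasShape_iff] at h h'
  rcases hg with ⟨h1, h2, h3⟩ | ⟨h1, h2, h3⟩ | ⟨h1, h2, h3⟩ | ⟨h1, h2, h3⟩
  · exact (h c).carry (h' c) (Or.inl h1) (Or.inl h2) (Or.inl h3)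
  · exact (h c).carry (h' c) (Or.inl h1) (Or.inl h2) (Or.inr h3)
  · exact (h c).carry (h' c) (Or.inr h1) (Or.inl h2) (Or.inl h3)
  · exact (h c).carry (h' c) (Or.inr h1) (Or.inl h2) (Or.inr h3)

/-- The faces behind the over-strand, on the side of the outgoing under-strand. -/
theorem carries_far (h : d.HasShape w m) (h' : d'.HasShape w m) {g : PSL(2, ℂ)} {c : D.Crossing}
    (hg : Carries d d' g (D.outEdge c .over) (D.region c .north) ∨
      Carries d d' g (D.outEdge c .over) (D.region c (D.orient c .west)) ∨
      Carries d d' g (D.outEdge c .under) (D.region c .north) ∨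
      Carries d d' g (D.outEdge c .under) (D.region c (D.orient c .west))) :
    g • d.cusp (D.outEdge c .over) = d'.cusp (D.outEdge c .over) ∧
    g • d.cusp (D.outEdge c .under) = d'.cusp (D.outEdge c .under) ∧
    g • d.top = d'.top ∧
    g • d.bottom (D.region c .north) = d'.bottom (D.region c .north) ∧
    g • d.bottom (D.region c (D.orient c .west)) = d'.bottom (D.region c (D.orient c .west)) := by
  rw [hasShape_iff] at h h'
  have ho := d.signed_smul_cusp c
  have hu := d.signed_smul_cusp_under c
  have hS := D.coloring_over_in d.bottom_eq c
  have hA := D.coloring_over_out d.bottom_eq c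
  have ho' := d'.signed_smul_cusp c
  have hu' := d'.signed_smul_cusp_under c
  have hS' := D.coloring_over_in d'.bottom_eq c
  have hA' := D.coloring_over_out d'.bottom_eq c
  -- Faces behind the over-strand become faces at the other upper vertex of the chosen octahedron
  -- after translation by the signed over-meridian. On that octahedron `g` acts through this twisted
  -- element.
  have hc := (h c).carry (h' c) (g := D.signed c (ρ' (D.meridian (D.outEdge c .over))) * g *
    (D.signed c (ρ (D.meridian (D.outEdge c .over))))⁻¹)
  set x := D.signed c (ρ (D.meridian (D.outEdge c .over)))
  set x' := D.signed c (ρ' (D.meridian (D.outEdge c .over)))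
  have key : ∀ {a a' b b' : CP1}, x • a = b → x' • a' = b' →
      ((x' * g * x⁻¹) • b = b' ↔ g • a = a') := by
    rintro a a' _ _ rfl rfl
    rw [mul_smul, mul_smul, inv_smul_smul, smul_left_cancel_iff]
  rw [key ho ho', key hu hu', key hS.symm hS'.symm, key hA.symm hA'.symm,
    key (b := x • d.top) (b' := x' • d'.top) rfl rfl] at hc
  rcases hg with ⟨h1, h2, h3⟩ | ⟨h1, h2, h3⟩ | ⟨h1, h2, h3⟩ | ⟨h1, h2, h3⟩
  · obtain ⟨c1, c2, -, -, c5, c6⟩ := hc (Or.inl h1) (Or.inr h2) (Or.inr h3)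
    exact ⟨c1, c2, h2, c6, c5⟩
  · obtain ⟨c1, c2, -, -, c5, c6⟩ := hc (Or.inl h1) (Or.inr h2) (Or.inl h3)
    exact ⟨c1, c2, h2, c6, c5⟩
  · obtain ⟨c1, c2, -, -, c5, c6⟩ := hc (Or.inr h1) (Or.inr h2) (Or.inr h3)
    exact ⟨c1, c2, h2, c6, c5⟩
  · obtain ⟨c1, c2, -, -, c5, c6⟩ := hc (Or.inr h1) (Or.inr h2) (Or.inl h3)
    exact ⟨c1, c2, h2, c6, c5⟩

theorem carries_inEdge_over {g : PSL(2, ℂ)} {c : D.Crossing} {r : D.Region} :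
    Carries d d' g (D.inEdge c .over) r ↔ Carries d d' g (D.outEdge c .over) r := by
  unfold Carries
  rw [d.cusp_over, d'.cusp_over]

/-- The faces at the viewer in front of the over-strand lie on one developed octahedron, so carrying
one of them means carrying all. The next lemma does this for the faces behind. -/
theorem carries_near_iff (h : d.HasShape w m) (h' : d'.HasShape w m) (g : PSL(2, ℂ))
    (c : D.Crossing) :
    (Carries d d' g (D.inEdge c .over) (D.region c .south) ↔
      Carries d d' g (D.outEdge c .over) (D.region c (D.orient c .east))) ∧
    (Carries d d' g (D.inEdge c .under) (D.region c .south) ↔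
      Carries d d' g (D.outEdge c .over) (D.region c (D.orient c .east))) ∧
    (Carries d d' g (D.inEdge c .under) (D.region c (D.orient c .east)) ↔
      Carries d d' g (D.outEdge c .over) (D.region c (D.orient c .east))) := by
  have key := carries_near h h' (g := g) (c := c)
  rw [carries_inEdge_over]
  unfold Carries at *
  tauto

theorem carries_far_iff (h : d.HasShape w m) (h' : d'.HasShape w m) (g : PSL(2, ℂ))
    (c : D.Crossing) :
    (Carries d d' g (D.inEdge c .over) (D.region c (D.orient c .west)) ↔
      Carries d d' g (D.outEdge c .over) (D.region c .north)) ∧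
    (Carries d d' g (D.outEdge c .under) (D.region c .north) ↔
      Carries d d' g (D.outEdge c .over) (D.region c .north)) ∧
    (Carries d d' g (D.outEdge c .under) (D.region c (D.orient c .west)) ↔
      Carries d d' g (D.outEdge c .over) (D.region c .north)) := by
  have key := carries_far h h' (g := g) (c := c)
  rw [carries_inEdge_over]
  unfold Carries at *
  tauto

/-- Crossing an edge between its two sides is possible because every component passes under some
crossing, where the faces on both sides of the under-strand belong to the same octahedron. -/
theorem carries_left_iff_right (hD : D.EveryComponentOverUnder) (h : d.HasShape w m)
    (h' : d'.HasShape w m) (g : PSL(2, ℂ)) (e : D.Edge) :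
    Carries d d' g e (D.leftRegion e) ↔ Carries d d' g e (D.rightRegion e) := by
  obtain ⟨c, hc⟩ := (hD (D.component e)).2
  have hunder : ∀ c, Carries d d' g (D.outEdge c .under) (D.leftRegion (D.outEdge c .under)) ↔
      Carries d d' g (D.outEdge c .under) (D.rightRegion (D.outEdge c .under)) := by
    intro c
    obtain ⟨-, k2, k3⟩ := carries_far_iff h h' g c
    by_cases hp : D.positive c
    · obtain ⟨-, -, -, -, -, -, h1, h2⟩ := D.sides_of_positive hp
      rw [h1, h2, k2]
      simpa [orient, hp] using k3
    · obtain ⟨-, -, -, -, -, -, h1, h2⟩ := D.sides_of_negative hp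
      rw [h1, h2, k2]
      simpa [orient, hp, Corner.reflect] using k3.symm
  refine D.component_induction (P := fun e => Carries d d' g e (D.leftRegion e) ↔
    Carries d d' g e (D.rightRegion e)) ?_ hc (hunder c)
  rintro c (_ | _) hin
  -- Along the over-strand the near octahedron links the faces before and after the crossing on one
  -- side, and the far octahedron those on the other side, so the equivalence of left and right
  -- persists.
  · obtain ⟨n1, -⟩ := carries_near_iff h h' g c
    obtain ⟨f1, -⟩ := carries_far_iff h h' g c
    by_cases hp : D.positive c
    · obtain ⟨h1, h2, -, -, h3, h4, -⟩ := D.sides_of_positive hp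
      rw [h1, h2] at hin
      rw [h3, h4]
      simp only [orient, hp, if_true] at n1 f1
      rw [← n1, ← f1, hin]
    · obtain ⟨h1, h2, -, -, h3, h4, -⟩ := D.sides_of_negative hp
      rw [h1, h2] at hin
      rw [h3, h4]
      simp only [orient, hp, Corner.reflect] at n1 f1
      rw [← f1]
      exact n1.symm.trans hin
  · exact hunder c

/-- The near and far octahedra are different lifts; `carries_left_iff_right` on the outgoing
over-strand joins them. All faces at one crossing can then be compared with a single reference face.
-/
theorem carries_crossing (hD : D.EveryComponentOverUnder) (h : d.HasShape w m)
    (h' : d'.HasShape w m) (g : PSL(2, ℂ)) (c : D.Crossing) (s : Strand) :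
    (Carries d d' g (D.inEdge c s) (D.leftRegion (D.inEdge c s)) ↔
      Carries d d' g (D.outEdge c .over) (D.region c .north)) ∧
    (Carries d d' g (D.outEdge c s) (D.leftRegion (D.outEdge c s)) ↔
      Carries d d' g (D.outEdge c .over) (D.region c .north)) ∧
    (Carries d d' g (D.outEdge c .over) (D.region c (D.orient c .east)) ↔
      Carries d d' g (D.outEdge c .over) (D.region c .north)) := by
  obtain ⟨n1, n2, n3⟩ := carries_near_iff h h' g c
  obtain ⟨f1, f2, f3⟩ := carries_far_iff h h' g c
  have hoo := carries_left_iff_right hD h h' g (D.outEdge c .over)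
  by_cases hp : D.positive c
  · obtain ⟨h1, -, h3, -, h5, h6, h7, -⟩ := D.sides_of_positive hp
    simp only [orient, hp, if_true] at n1 n2 n3 f1 f2 f3 ⊢
    rw [h5, h6] at hoo
    cases s
    · rw [h1, h5]
      exact ⟨f1, Iff.rfl, hoo.symm⟩
    · rw [h3, h7]
      exact ⟨n2.trans hoo.symm, f3, hoo.symm⟩
  · obtain ⟨h1, -, h3, -, h5, h6, h7, -⟩ := D.sides_of_negative hp
    simp only [orient, hp, Corner.reflect, Bool.false_eq_true, if_false] at n1 n2 n3 f1 f2 f3 ⊢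
    rw [h5, h6] at hoo
    cases s
    · rw [h1, h5]
      exact ⟨n1.trans hoo, hoo, hoo⟩
    · rw [h3, h7]
      exact ⟨n3.trans hoo, f2, hoo⟩

/-- Two developing maps of the same shape differ by a Möbius transformation. -/
theorem exists_carries (hD : D.EveryComponentOverUnder) (h : d.HasShape w m)
    (h' : d'.HasShape w m) : ∃ g : PSL(2, ℂ), ∀ c : D.Crossing,
      Carries d d' g (D.outEdge c .over) (D.region c .north) := by
  obtain ⟨c₀⟩ := D.nonempty_crossing
  obtain ⟨-, -, ⟨a1, -, a2, -, a3, -⟩, -⟩ := hasShape_iff d w m |>.mp h c₀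
  obtain ⟨-, -, ⟨b1, -, b2, -, b3, -⟩, -⟩ := hasShape_iff d' w m |>.mp h' c₀
  obtain ⟨g, g1, g2, g3⟩ := CP1.exists_smul_eq a1 a2 a3 b1 b2 b3
  refine ⟨g, fun c => ?_⟩
  refine D.crossing_induction
    (P := fun c => Carries d d' g (D.outEdge c .over) (D.region c .north)) ?_ c₀ c
    ((carries_crossing hD h h' g c₀ .over).2.2.mp ⟨g1, g3, g2⟩)
  intro e
  have e1 := (carries_crossing hD h h' g e.1 e.2).2.1
  have e2 := (carries_crossing hD h h' g (D.next e).1 (D.next e).2).1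
  rw [inEdge_next] at e2
  exact e1.symm.trans e2

/-- The transformation matching the developing maps must intertwine the over-meridians. Every
component passes over some crossing, and the Wirtinger relations carry the conjugacy from there
along the component. -/
theorem exists_conj (hD : D.EveryComponentOverUnder) (h : d.HasShape w m)
    (h' : d'.HasShape w m) : ∃ g : PSL(2, ℂ), ∀ x, ρ' x = g * ρ x * g⁻¹ := by
  obtain ⟨g, hg⟩ := exists_carries hD h h'
  have hover : ∀ c, ρ' (D.meridian (D.outEdge c .over)) =
      g * ρ (D.meridian (D.outEdge c .over)) * g⁻¹ := by
    intro c
    obtain ⟨h1, h2, h3⟩ := hg c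
    obtain ⟨-, -, -, k4, -, k6⟩ := carries_near h h'
      (Or.inr (Or.inl ((carries_crossing hD h h' g c .over).2.2.mpr ⟨h1, h2, h3⟩)))
    have ho := d.signed_smul_cusp c
    have hA := D.coloring_over_out d.bottom_eq c
    have ho' := d'.signed_smul_cusp c
    have hA' := D.coloring_over_out d'.bottom_eq c
    obtain ⟨-, -, ⟨a1, a2, -, a3, -⟩, -⟩ := hasShape_iff d w m |>.mp h c
    have key : D.signed c (ρ' (D.meridian (D.outEdge c .over))) =
        g * D.signed c (ρ (D.meridian (D.outEdge c .over))) * g⁻¹ := by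
      set x := D.signed c (ρ (D.meridian (D.outEdge c .over)))
      set x' := D.signed c (ρ' (D.meridian (D.outEdge c .over)))
      rw [eq_mul_inv_iff_mul_eq]
      -- The over-meridian fixes the first of these points and takes the other two to vertices of
      -- the near octahedron, which `g` also carries to their counterparts. Three distinct points
      -- determine the transformation.
      refine CP1.eq_of_smul_eq (x := d.cusp (D.outEdge c .over))
        (y := d.bottom (D.region c .north)) (z := d.top) ?_ ?_ ?_ ?_ ?_ ?_
      · intro hne
        rw [← hne, ho] at hA
        exact a1 hA.symm
      · intro hne
        rw [← hne, ho] at a2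
        exact a2 rfl
      · intro hne
        rw [hA, hne] at a3
        exact a3 rfl
      · rw [mul_smul, mul_smul, h1, ho', ho, h1]
      · rw [mul_smul, mul_smul, h3, ← hA', ← hA, k6]
      · rw [mul_smul, mul_smul, h2, k4]
    unfold signed at key
    split_ifs at key
    · exact key
    · rw [← inv_inj, key]
      group
  have hall : ∀ e, ρ' (D.meridian e) = g * ρ (D.meridian e) * g⁻¹ := by
    intro e
    obtain ⟨c, hc⟩ := (hD (D.component e)).1
    refine D.component_induction
      (P := fun e => ρ' (D.meridian e) = g * ρ (D.meridian e) * g⁻¹) ?_ hc (hover c)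
    rintro c (_ | _) hin
    · exact hover c
    · have hm : D.meridian (D.outEdge c .under) =
          (D.signed c (D.meridian (D.outEdge c .over)))⁻¹ * D.meridian (D.inEdge c .under) *
            D.signed c (D.meridian (D.outEdge c .over)) := by
        rw [mul_assoc, D.meridian_under, inv_mul_cancel_left]
      have hs : ρ' (D.signed c (D.meridian (D.outEdge c .over))) =
          g * ρ (D.signed c (D.meridian (D.outEdge c .over))) * g⁻¹ := by
        rw [map_signed, map_signed]
        unfold signed
        split_ifs
        · exact hover c
        · rw [hover c]
          group
      simp only [hm, map_mul, map_inv, hs, hin]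
      group
  refine ⟨g, fun x => ?_⟩
  have hext : ρ' = (MulAut.conj g).toMonoidHom.comp ρ := PresentedGroup.ext fun e => hall e
  rw [hext]
  rfl

end DevelopingMap

end LinkDiagram

/-- A representation of the link group that is non-trivial on meridians and lifts to
`SL(2, ℂ)` is, up to conjugation, the holonomy representation of a non-degenerate solution. -/
theorem theorem1p2 (D : LinkDiagram) (hD : D.EveryComponentOverUnder)
    (ρ : D.LinkGroup →* PSL(2, ℂ))
    (hρ : ∀ e : D.Edge, ρ (D.meridian e) ≠ 1)
    (hlift : ∃ ρ' : D.LinkGroup →* SL(2, ℂ), ∀ x, ((ρ' x : SL(2, ℂ)) : PSL(2, ℂ)) = ρ x) :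
    ∃ (w : D.Region → ℂˣ) (m : D.Component → ℂˣ),
      D.IsNondegenerate (fun r => (w r : ℂ)) (fun i => (m i : ℂ)) ∧
      D.IsSolution (fun r => (w r : ℂ)) (fun i => (m i : ℂ)) ∧
      D.IsHolonomy (fun r => (w r : ℂ)) (fun i => (m i : ℂ)) ρ ∧
      ∀ ρ' : D.LinkGroup →* PSL(2, ℂ),
        D.IsHolonomy (fun r => (w r : ℂ)) (fun i => (m i : ℂ)) ρ' →
        ∃ g : PSL(2, ℂ), ∀ x, ρ' x = g * ρ x * g⁻¹ := by
  obtain ⟨φ, hφ⟩ := hlift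
  obtain ⟨V, hV⟩ := D.exists_vectorData φ fun e => by rw [hφ]; exact hρ e
  refine ⟨fun r => Units.mk0 (V.w r) (V.generic_edge r),
    fun i => Units.mk0 (V.m i) (inv_ne_zero (V.l_ne i)), ?_⟩
  refine ⟨D.isNondegenerate_of_nonrealArguments _ _ hV, V.isSolution hV,
    ⟨V.developingMap hφ, V.hasShape hφ⟩, ?_⟩
  rintro ρ' ⟨d', hd'⟩
  exact LinkDiagram.DevelopingMap.exists_conj hD (V.hasShape hφ) hd'
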